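/- Let $C\subset\mathbb R^3$ be a closed curve, given by a smooth ($C^\infty$) regular parametrization $x:\mathbb R\to\mathbb R^3$ ($x'\neq0$ everywhere) that is periodic with period $p>0$; all integrals over $C$ are taken over one period. Spheres of $\mathbb S^3=\mathbb R^3\cup\{\infty\}$ (in $\mathbb R^3$: round spheres and planes) are described as follows. Let $\langle v,w\rangle=v_1w_1+v_2w_2+v_3w_3+v_4w_4-v_5w_5$ on $\mathbb R^5$ and $\Lambda^4=\{\sigma:\langle\sigma,\sigma\rangle=1\}$, and for $y\in\mathbb R^3$ put $\hat y=\bigl(y,\tfrac{|y|^2-1}2,\tfrac{|y|^2+1}2\bigr)$; then $\sigma\in\Lambda^4$ represents the oriented sphere or plane $\{y:\langle\hat y,\sigma\rangle=0\}$. The curve has contact of order $\ge k$ at $x(s)$ with this sphere if $\langle\widehat{x(\cdot)},\sigma\rangle$ vanishes at $s$ together with its derivatives up to order $k$, and it has contact of order $\ge k$ with a circle or line, written as the transversal intersection of two such spheres, if it has contact of order $\ge k$ with both of them. A vertex is a point where the osculating circle has contact of order $\ge3$ with the curve, that is, where some circle or line has contact of order $\ge 3$. Suppose that $C$ has no vertices,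 and that at no point of $C$ does any sphere or plane have contact of order $4$ or more with $C$. Let $\gamma(s)=\widehat{x(s)}$, let $\nu=\gamma\wedge\gamma'\wedge\gamma''\wedge\gamma'''$ be the vector defined by $\langle\nu,w\rangle=\det(\gamma,\gamma',\gamma'',\gamma''',w)$ for all $w\in\mathbb R^5$, let $\sigma=\nu/\langle\nu,\nu\rangle^{1/2}$ be the path of osculating spheres in $\Lambda^4$, and let $\omega=\langle\sigma'(s),\sigma'(s)\rangle^{1/2}\,ds$ be the pull-back by $\sigma$ of the arc-length element of $\Lambda^4$. Let $u$ be the Euclidean arc length of $C$, let $k,\tau$ be its curvature and torsion, and let a prime on $k,\tau$ denote $d/du$. Let the conformal arc length $t$ and the conformal torsion $T$ be given by $$dt=(k'^2+k^2\tau^2)^{1/4}\,du,\qquad T=\frac{2k'^2\tau+k^2\tau^3+kk'\tau'-kk''\tau}{(k'^2+k^2\tau^2)^{5/4}}.$$ At points where $k=0$, these expressions are understood through the identities $k'^2+k^2\tau^2=|P|^2$ and $2k'^2\tau+k^2\tau^3+kk'\tau'-kk''\tau=\det\bigl(\tfrac{dx}{du},P,\tfrac{dP}{du}\bigr)$, where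 $P$ is the component of $\tfrac{d^3x}{du^3}$ orthogonal to $\tfrac{dx}{du}$. Then $T\neq0$ at every point of $C$, and $$\int_C\omega=\left|\int_C T\,dt\right|\ge 2\pi .$$ -/

import Mathlib

open scoped ContDiff

noncomputable section

namespace ConformalCurve

/-- Euclidean three-space. -/
abbrev E3 : Type := EuclideanSpace ℝ (Fin 3)

/-- The vector space underlying five-dimensional Lorentz space. -/
abbrev L5 : Type := Fin 5 → ℝ

/-- The Lorentz form `x₁y₁ + x₂y₂ + x₃y₃ + x₄y₄ - x₅y₅`. -/
def lor (v w : L5) : ℝ := v 0 * w 0 + v 1 * w 1 + v 2 * w 2 + v 3 * w 3 - v 4 * w 4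

/-- The length `⟨v, v⟩ ^ (1/2)` of a space-like (or null) vector. -/
def lorNorm (v : L5) : ℝ := Real.sqrt (lor v v)

/-- The de Sitter space `Λ⁴`, the space of oriented spheres (planes of `ℝ³` included). -/
def deSitter : Set L5 := {σ | lor σ σ = 1}

/-- Inverse stereographic projection `ℝ³ → 𝕊³`, written as a section of the light cone:
a point `y` is sent to `(y, (|y|² - 1)/2, (|y|² + 1)/2)`. -/
def lift (y : E3) : L5 := ![y 0, y 1, y 2, (‖y‖ ^ 2 - 1) / 2, (‖y‖ ^ 2 + 1) / 2]

/-- The points of `ℝ³` on the sphere represented by `σ`. -/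
def sphereSet (σ : L5) : Set E3 := {y | lor (lift y) σ = 0}

/-- The vector of `Λ⁴` representing the round sphere with centre `m` and radius `r`. -/
def roundSphere (m : E3) (r : ℝ) : L5 :=
  ![m 0 / r, m 1 / r, m 2 / r, (‖m‖ ^ 2 - r ^ 2 - 1) / (2 * r), (‖m‖ ^ 2 - r ^ 2 + 1) / (2 * r)]

/-- The vector of `Λ⁴` representing the plane `⟨n, y⟩ = d`, where `n` is a unit vector. -/
def planeSphere (n : E3) (d : ℝ) : L5 := ![n 0, n 1, n 2, d, d]

lemma norm_sq_E3 (y : E3) : ‖y‖ ^ 2 = y 0 ^ 2 + y 1 ^ 2 + y 2 ^ 2 := by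
  rw [EuclideanSpace.real_norm_sq_eq, Fin.sum_univ_three]

lemma lor_lift_lift (y z : E3) : lor (lift y) (lift z) = -‖y - z‖ ^ 2 / 2 := by
  simp only [lor, lift, norm_sq_E3]
  simp
  ring

lemma roundSphere_mem (m : E3) {r : ℝ} (hr : r ≠ 0) : roundSphere m r ∈ deSitter := by
  simp only [deSitter, Set.mem_ofPred_eq, lor, roundSphere, norm_sq_E3]
  simp
  field_simp
  ring

lemma lor_roundSphere (y m : E3) {r : ℝ} (hr : r ≠ 0) :
    lor (lift y) (roundSphere m r) = (r ^ 2 - ‖y - m‖ ^ 2) / (2 * r) := by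
  simp only [lor, lift, roundSphere, norm_sq_E3]
  simp
  field_simp
  ring

lemma planeSphere_mem (n : E3) (hn : ‖n‖ = 1) (d : ℝ) : planeSphere n d ∈ deSitter := by
  have h := norm_sq_E3 n
  rw [hn] at h
  simp only [deSitter, Set.mem_ofPred_eq, lor, planeSphere]
  simp
  linarith

lemma lor_planeSphere (y n : E3) (d : ℝ) :
    lor (lift y) (planeSphere n d) = y 0 * n 0 + y 1 * n 1 + y 2 * n 2 - d := by
  simp only [lor, lift, planeSphere]
  simp
  ring

/-- A closed curve: a smooth regular map `x : ℝ → ℝ³` with period `p > 0`. -/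
structure IsClosedCurve (x : ℝ → E3) (p : ℝ) : Prop where
  smooth : ContDiff ℝ ∞ x
  regular : ∀ s, deriv x s ≠ 0
  period_pos : 0 < p
  periodic : Function.Periodic x p

/-- The curve `x` has at `x s` contact of order at least `k` with the sphere `σ`: the defining
function of the sphere vanishes along the curve, at `s`, with all derivatives up to order `k`. -/
def HasContact (x : ℝ → E3) (s : ℝ) (σ : L5) (k : ℕ) : Prop :=
  ∀ j ≤ k, iteratedDeriv j (fun t => lor (lift (x t)) σ) s = 0

/-- Contact of order at least `k` with the circle in which the spheres `σ₁` and `σ₂` meet.  Two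
elements of `Λ⁴` represent spheres meeting transversally in a circle (or line) exactly when
`|⟨σ₁, σ₂⟩| < 1`. -/
def HasCircleContact (x : ℝ → E3) (s : ℝ) (σ₁ σ₂ : L5) (k : ℕ) : Prop :=
  HasContact x s σ₁ k ∧ HasContact x s σ₂ k

/-- A vertex: some circle (necessarily the osculating one) has contact of order at least `3`. -/
def IsVertex (x : ℝ → E3) (s : ℝ) : Prop :=
  ∃ σ₁ ∈ deSitter, ∃ σ₂ ∈ deSitter, |lor σ₁ σ₂| < 1 ∧ HasCircleContact x s σ₁ σ₂ 3

/-- A spherical point: some sphere has contact of order at least `4`. -/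
def IsSpherical (x : ℝ → E3) (s : ℝ) : Prop :=
  ∃ σ ∈ deSitter, HasContact x s σ 4

/-- The Lorentz exterior product of four vectors. -/
def wedge (a b c d : L5) : L5 := fun i =>
  (if i = 4 then -1 else 1) * Matrix.det (Matrix.of ![a, b, c, d, Pi.single i 1])

/-- The exterior product is characterised by `⟨ν, w⟩ = det (a, b, c, d, w)`. -/
lemma lor_wedge (a b c d w : L5) :
    lor (wedge a b c d) w = Matrix.det (Matrix.of ![a, b, c, d, w]) := by
  have key : ∀ v : L5, Matrix.det (Matrix.of ![a, b, c, d, v])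
      = Matrix.detRowAlternating.toMultilinearMap.toLinearMap ![a, b, c, d, 0] 4 v := by
    intro v
    simp only [MultilinearMap.toLinearMap_apply]
    congr 1
    ext i j
    fin_cases i <;> simp [Function.update]
  have hw : w = ∑ i, w i • (Pi.single i 1 : L5) := by
    ext j
    simp [Finset.sum_apply, Pi.single_apply]
  rw [key w]
  conv_rhs => rw [hw, map_sum]
  simp_rw [LinearMap.map_smul, ← key]
  simp [Fin.sum_univ_five, lor, wedge]
  ring

/-- `ν = γ ∧ γ' ∧ γ'' ∧ γ'''` for the lift `γ` of the curve to the light cone. -/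
def oscVector (x : ℝ → E3) (s : ℝ) : L5 :=
  wedge (lift (x s)) (iteratedDeriv 1 (fun t => lift (x t)) s)
    (iteratedDeriv 2 (fun t => lift (x t)) s) (iteratedDeriv 3 (fun t => lift (x t)) s)

/-- The oriented osculating sphere `σ = ν / ⟨ν, ν⟩ ^ (1/2)`. -/
def oscSphere (x : ℝ → E3) (s : ℝ) : L5 :=
  (lorNorm (oscVector x s))⁻¹ • oscVector x s

/-- `∫_C ω` over one period, where `ω` is the pull-back of the arc-length element of `Λ⁴` under the
path of osculating spheres. -/
def omegaIntegral (x : ℝ → E3) (p : ℝ) : ℝ :=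
  ∫ s in (0 : ℝ)..p, lorNorm (deriv (oscSphere x) s)

/-- The derivative of `f` with respect to the arc length `u` of the curve `x`. -/
def arcDeriv {F : Type*} [NormedAddCommGroup F] [NormedSpace ℝ F] (x : ℝ → E3) (f : ℝ → F)
    (s : ℝ) : F :=
  ‖deriv x s‖⁻¹ • deriv f s

/-- The unit tangent. -/
def tangent (x : ℝ → E3) : ℝ → E3 := arcDeriv x x

/-- The curvature vector `d²x/du²`. -/
def curvVec (x : ℝ → E3) : ℝ → E3 := arcDeriv x (tangent x)

/-- The component normal to the curve of `d³x/du³`, which is `k' n + k τ b` in a Frenet frame. -/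
def normalThird (x : ℝ → E3) (s : ℝ) : E3 :=
  arcDeriv x (curvVec x) s - (inner ℝ (arcDeriv x (curvVec x) s) (tangent x s)) • tangent x s

/-- The determinant of three vectors of `ℝ³`. -/
def det3 (a b c : E3) : ℝ := Matrix.det (Matrix.of ![(a : Fin 3 → ℝ), b, c])

/-- `k'² + k² τ²`, in a form that makes sense also where the curvature vanishes. -/
def confSq (x : ℝ → E3) (s : ℝ) : ℝ := ‖normalThird x s‖ ^ 2

/-- `2 k'² τ + k² τ³ + k k' τ' - k k'' τ`, in a form that makes sense also where the curvature
vanishes. -/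
def torsionNum (x : ℝ → E3) (s : ℝ) : ℝ :=
  det3 (tangent x s) (normalThird x s) (arcDeriv x (normalThird x) s)

/-- The conformal torsion
`T = (2 k'² τ + k² τ³ + k k' τ' - k k'' τ) / (k'² + k² τ²) ^ (5/4)`. -/
def confTorsion (x : ℝ → E3) (s : ℝ) : ℝ := torsionNum x s / confSq x s ^ (5 / 4 : ℝ)

/-- The density `dt/ds` of conformal arc length, `dt = (k'² + k² τ²) ^ (1/4) du`. -/
def confSpeed (x : ℝ → E3) (s : ℝ) : ℝ := confSq x s ^ (1 / 4 : ℝ) * ‖deriv x s‖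

/-- `∫_C T dt` over one period. -/
def torsionIntegral (x : ℝ → E3) (p : ℝ) : ℝ :=
  ∫ s in (0 : ℝ)..p, confTorsion x s * confSpeed x s

/-- The curvature of a space curve. -/
def curvature (x : ℝ → E3) (s : ℝ) : ℝ := ‖curvVec x s‖

/-- The torsion of a space curve at a point where the curvature does not vanish. -/
def torsion (x : ℝ → E3) (s : ℝ) : ℝ :=
  det3 (tangent x s) (curvVec x s) (arcDeriv x (curvVec x) s) / curvature x s ^ 2

lemma det3_eq (a b c : E3) : det3 a b c =
    a 0 * (b 1 * c 2 - b 2 * c 1) - a 1 * (b 0 * c 2 - b 2 * c 0)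
      + a 2 * (b 0 * c 1 - b 1 * c 0) := by
  simp [det3, Matrix.det_fin_three]
  ring

lemma inner_E3 (a b : E3) : inner ℝ a b = a 0 * b 0 + a 1 * b 1 + a 2 * b 2 := by
  simp [PiLp.inner_apply, Fin.sum_univ_three]
  ring

lemma contDiff_arcDeriv {F : Type*} [NormedAddCommGroup F] [NormedSpace ℝ F] {x : ℝ → E3}
    (hx : ContDiff ℝ ∞ x) (hr : ∀ s, deriv x s ≠ 0) {f : ℝ → F} (hf : ContDiff ℝ ∞ f) :
    ContDiff ℝ ∞ (arcDeriv x f) := by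
  have h1 : ContDiff ℝ ∞ (deriv x) := (contDiff_infty_iff_deriv.1 hx).2
  have h2 : ContDiff ℝ ∞ (deriv f) := (contDiff_infty_iff_deriv.1 hf).2
  exact ((h1.norm ℝ hr).inv (fun s => norm_ne_zero_iff.2 (hr s))).smul h2

lemma arcDeriv_smul_add (x : ℝ → E3) {f g : ℝ → ℝ} {v w : ℝ → E3} {s : ℝ}
    (hf : DifferentiableAt ℝ f s) (hg : DifferentiableAt ℝ g s)
    (hv : DifferentiableAt ℝ v s) (hw : DifferentiableAt ℝ w s) :
    arcDeriv x (fun t => f t • v t + g t • w t) s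
      = arcDeriv x f s • v s + f s • arcDeriv x v s
        + (arcDeriv x g s • w s + g s • arcDeriv x w s) := by
  unfold arcDeriv
  have h : HasDerivAt (fun t => f t • v t + g t • w t)
      ((f s • deriv v s + deriv f s • v s) + (g s • deriv w s + deriv g s • w s)) s :=
    (hf.hasDerivAt.smul hv.hasDerivAt).add (hg.hasDerivAt.smul hw.hasDerivAt)
  rw [h.deriv]
  simp only [smul_eq_mul]
  module

lemma arcDeriv_inner {x f g : ℝ → E3} {s : ℝ} (hf : DifferentiableAt ℝ f s)
    (hg : DifferentiableAt ℝ g s) :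
    arcDeriv x (fun t => inner ℝ (f t) (g t)) s
      = inner ℝ (f s) (arcDeriv x g s) + inner ℝ (arcDeriv x f s) (g s) := by
  simp only [arcDeriv, deriv_inner_apply ℝ hf hg, inner_smul_left, inner_smul_right, smul_eq_mul]
  simp
  ring

lemma arcDeriv_det3 {x f g h : ℝ → E3} {s : ℝ} (hf : DifferentiableAt ℝ f s)
    (hg : DifferentiableAt ℝ g s) (hh : DifferentiableAt ℝ h s) :
    arcDeriv x (fun t => det3 (f t) (g t) (h t)) s
      = det3 (arcDeriv x f s) (g s) (h s) + det3 (f s) (arcDeriv x g s) (h s)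
        + det3 (f s) (g s) (arcDeriv x h s) := by
  have c : ∀ {v : ℝ → E3}, DifferentiableAt ℝ v s → ∀ i : Fin 3,
      HasDerivAt (fun t => v t i) (deriv v s i) s := by
    intro v hv i
    exact (EuclideanSpace.proj (𝕜 := ℝ) i).hasFDerivAt.comp_hasDerivAt s hv.hasDerivAt
  have H := (((c hf 0).mul (((c hg 1).mul (c hh 2)).sub ((c hg 2).mul (c hh 1)))).sub
    ((c hf 1).mul (((c hg 0).mul (c hh 2)).sub ((c hg 2).mul (c hh 0))))).add
    ((c hf 2).mul (((c hg 0).mul (c hh 1)).sub ((c hg 1).mul (c hh 0))))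
  have e : (fun t => det3 (f t) (g t) (h t)) = fun t =>
      f t 0 * (g t 1 * h t 2 - g t 2 * h t 1) - f t 1 * (g t 0 * h t 2 - g t 2 * h t 0)
      + f t 2 * (g t 0 * h t 1 - g t 1 * h t 0) := by
    funext t
    exact det3_eq _ _ _
  rw [e]
  simp only [arcDeriv, det3_eq, smul_eq_mul]
  have H' := H.deriv
  simp only [Pi.mul_def, Pi.sub_def, Pi.add_def] at H'
  rw [H']
  simp
  ring

lemma arcDeriv_mul {x : ℝ → E3} {f g : ℝ → ℝ} {s : ℝ} (hf : DifferentiableAt ℝ f s)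
    (hg : DifferentiableAt ℝ g s) :
    arcDeriv x (fun t => f t * g t) s = arcDeriv x f s * g s + f s * arcDeriv x g s := by
  have H := (hf.hasDerivAt.mul hg.hasDerivAt).deriv
  simp only [Pi.mul_def] at H
  simp only [arcDeriv, H, smul_eq_mul]
  ring

lemma arcDeriv_congr {x : ℝ → E3} {f g : ℝ → ℝ} {s : ℝ} (h : f =ᶠ[nhds s] g) :
    arcDeriv x f s = arcDeriv x g s := by
  simp only [arcDeriv, h.deriv_eq]

/-- Where the curvature does not vanish, `confSq` and `torsionNum` are the classical expressions in
the curvature, the torsion and their derivatives with respect to arc length. -/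
theorem confSq_torsionNum_eq {x : ℝ → E3} (hx : ContDiff ℝ ∞ x) (hr : ∀ s, deriv x s ≠ 0)
    {s : ℝ} (hk : curvature x s ≠ 0) :
    confSq x s = arcDeriv x (curvature x) s ^ 2 + curvature x s ^ 2 * torsion x s ^ 2 ∧
    torsionNum x s =
      2 * arcDeriv x (curvature x) s ^ 2 * torsion x s + curvature x s ^ 2 * torsion x s ^ 3
      + curvature x s * arcDeriv x (curvature x) s * arcDeriv x (torsion x) s
      - curvature x s * arcDeriv x (arcDeriv x (curvature x)) s * torsion x s := by
  have c1 : ContDiff ℝ ∞ (tangent x) := contDiff_arcDeriv hx hr hx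
  have c2 : ContDiff ℝ ∞ (curvVec x) := contDiff_arcDeriv hx hr c1
  have c3 : ContDiff ℝ ∞ (arcDeriv x (curvVec x)) := contDiff_arcDeriv hx hr c2
  have d1 : ∀ t, DifferentiableAt ℝ (tangent x) t := fun t => c1.differentiable (by simp) t
  have d2 : ∀ t, DifferentiableAt ℝ (curvVec x) t := fun t => c2.differentiable (by simp) t
  have d3 : ∀ t, DifferentiableAt ℝ (arcDeriv x (curvVec x)) t :=
    fun t => c3.differentiable (by simp) t
  have a11 : ∀ t, inner ℝ (tangent x t) (tangent x t) = (1 : ℝ) := by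
    intro t
    rw [real_inner_self_eq_norm_sq, tangent, arcDeriv, norm_smul, norm_inv, norm_norm,
      inv_mul_cancel₀ (norm_ne_zero_iff.2 (hr t)), one_pow]
  have a12 : ∀ t, inner ℝ (tangent x t) (curvVec x t) = (0 : ℝ) := by
    intro t
    have h := arcDeriv_inner (x := x) (d1 t) (d1 t)
    rw [show (fun t => inner ℝ (tangent x t) (tangent x t)) = fun _ => (1 : ℝ) from funext a11] at h
    rw [real_inner_comm (tangent x t) (arcDeriv x (tangent x) t)] at h
    have h0 : arcDeriv x (fun _ : ℝ => (1 : ℝ)) t = 0 := by simp [arcDeriv]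
    have h2 : inner ℝ (tangent x t) (arcDeriv x (tangent x) t) = (0 : ℝ) := by
      rw [real_inner_comm] at h ⊢
      linarith
    exact h2
  have a13 : ∀ t, inner ℝ (tangent x t) (arcDeriv x (curvVec x) t)
      = -(inner ℝ (curvVec x t) (curvVec x t) : ℝ) := by
    intro t
    have h := arcDeriv_inner (x := x) (d1 t) (d2 t)
    rw [show (fun t => inner ℝ (tangent x t) (curvVec x t)) = fun _ => (0 : ℝ) from funext a12] at h
    have h0 : arcDeriv x (fun _ : ℝ => (0 : ℝ)) t = 0 := by simp [arcDeriv]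
    rw [h0] at h
    change (0 : ℝ) = _ + inner ℝ (curvVec x t) (curvVec x t) at h
    linarith
  have hP : normalThird x = fun t => (1 : ℝ) • arcDeriv x (curvVec x) t
      + (inner ℝ (curvVec x t) (curvVec x t) : ℝ) • tangent x t := by
    funext t
    rw [normalThird, real_inner_comm, a13 t]
    module
  have hDP := arcDeriv_smul_add x (f := fun _ => (1 : ℝ)) (s := s) (differentiableAt_const _)
    ((d2 s).inner ℝ (d2 s)) (d3 s) (d1 s)
  rw [← hP] at hDP
  have h0 : arcDeriv x (fun _ : ℝ => (1 : ℝ)) s = 0 := by simp [arcDeriv]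
  rw [h0] at hDP
  -- the curvature and its derivatives
  have ksq : ∀ t, curvature x t * curvature x t = inner ℝ (curvVec x t) (curvVec x t) := by
    intro t
    rw [real_inner_self_eq_norm_mul_norm]
    rfl
  have kcont : Continuous (curvature x) := c2.continuous.norm
  have knear : ∀ᶠ t in nhds s, curvature x t ≠ 0 := kcont.continuousAt.eventually_ne hk
  have kdiff : ∀ t, curvature x t ≠ 0 → DifferentiableAt ℝ (curvature x) t := fun t ht =>
    (d2 t).norm ℝ (norm_ne_zero_iff.1 ht)
  have kD : ∀ t, curvature x t ≠ 0 → curvature x t * arcDeriv x (curvature x) t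
      = inner ℝ (curvVec x t) (arcDeriv x (curvVec x) t) := by
    intro t ht
    have h := arcDeriv_mul (x := x) (kdiff t ht) (kdiff t ht)
    rw [show (fun t => curvature x t * curvature x t)
      = fun t => (inner ℝ (curvVec x t) (curvVec x t) : ℝ) from funext ksq,
      arcDeriv_inner (d2 t) (d2 t), real_inner_comm (curvVec x t)] at h
    rw [real_inner_comm] at h ⊢
    linarith
  have kDD : arcDeriv x (curvature x) s * arcDeriv x (curvature x) s
      + curvature x s * arcDeriv x (arcDeriv x (curvature x)) s
      = inner ℝ (curvVec x s) (arcDeriv x (arcDeriv x (curvVec x)) s)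
        + inner ℝ (arcDeriv x (curvVec x) s) (arcDeriv x (curvVec x) s) := by
    have e1 : arcDeriv x (curvature x) =ᶠ[nhds s] fun t =>
        (inner ℝ (curvVec x t) (arcDeriv x (curvVec x) t) : ℝ) / curvature x t := by
      filter_upwards [knear] with t ht
      rw [← kD t ht]
      field_simp
    have dk : DifferentiableAt ℝ (arcDeriv x (curvature x)) s :=
      (((d2 s).inner ℝ (d3 s)).div (kdiff s hk) hk).congr_of_eventuallyEq e1
    rw [← arcDeriv_inner (d2 s) (d3 s), ← arcDeriv_mul (kdiff s hk) dk]
    apply arcDeriv_congr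
    filter_upwards [knear] with t ht using kD t ht
  -- the torsion and its derivative
  have tsq : ∀ t, curvature x t ≠ 0 → torsion x t * inner ℝ (curvVec x t) (curvVec x t)
      = det3 (tangent x t) (curvVec x t) (arcDeriv x (curvVec x) t) := by
    intro t ht
    rw [← ksq t, torsion]
    field_simp
  have detdiff : DifferentiableAt ℝ
      (fun t => det3 (tangent x t) (curvVec x t) (arcDeriv x (curvVec x) t)) s := by
    have c : ∀ {v : ℝ → E3}, DifferentiableAt ℝ v s → ∀ i : Fin 3,
        DifferentiableAt ℝ (fun t => v t i) s := fun hv i =>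
      (EuclideanSpace.proj (𝕜 := ℝ) i).differentiableAt.comp s hv
    have u0 := c (d1 s) 0
    have u1 := c (d1 s) 1
    have u2 := c (d1 s) 2
    have v0 := c (d2 s) 0
    have v1 := c (d2 s) 1
    have v2 := c (d2 s) 2
    have w0 := c (d3 s) 0
    have w1 := c (d3 s) 1
    have w2 := c (d3 s) 2
    simp only [det3_eq]
    fun_prop
  have tdiff : DifferentiableAt ℝ (torsion x) s :=
    detdiff.div ((kdiff s hk).pow 2) (pow_ne_zero 2 hk)
  have tD : arcDeriv x (torsion x) s * (curvature x s * curvature x s)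
      + torsion x s * (2 * (curvature x s * arcDeriv x (curvature x) s))
      = det3 (tangent x s) (curvVec x s) (arcDeriv x (arcDeriv x (curvVec x)) s) := by
    have e := arcDeriv_mul (x := x) tdiff ((d2 s).inner ℝ (d2 s))
    rw [arcDeriv_inner (d2 s) (d2 s)] at e
    have e2 : arcDeriv x (fun t => torsion x t * inner ℝ (curvVec x t) (curvVec x t)) s
        = arcDeriv x (fun t => det3 (tangent x t) (curvVec x t) (arcDeriv x (curvVec x) t)) s := by
      apply arcDeriv_congr
      filter_upwards [knear] with t ht using tsq t ht
    rw [e2, arcDeriv_det3 (d1 s) (d2 s) (d3 s)] at e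
    rw [ksq s, kD s hk]
    rw [real_inner_comm (curvVec x s) (arcDeriv x (curvVec x) s)] at e
    have z1 : det3 (arcDeriv x (tangent x) s) (curvVec x s) (arcDeriv x (curvVec x) s) = 0 := by
      change det3 (curvVec x s) (curvVec x s) (arcDeriv x (curvVec x) s) = 0
      rw [det3_eq]
      ring
    have z2 : det3 (tangent x s) (arcDeriv x (curvVec x) s) (arcDeriv x (curvVec x) s) = 0 := by
      rw [det3_eq]
      ring
    rw [z1, z2] at e
    rw [real_inner_comm] at e ⊢
    linarith
  -- algebra
  have T0 := tsq s hk
  have K0 := ksq s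
  have K1 := kD s hk
  have A11 := a11 s
  have A12 := a12 s
  have A13 := a13 s
  have hPs := congrFun hP s
  rw [torsionNum, confSq, ← real_inner_self_eq_norm_sq, hDP, hPs]
  rw [← K0] at T0 A13
  rw [← K0]
  have hF2 : arcDeriv x (tangent x) s = curvVec x s := rfl
  rw [hF2]
  generalize arcDeriv x (fun t => inner ℝ (curvVec x t) (curvVec x t)) s = w
  generalize arcDeriv x (arcDeriv x (curvature x)) s = k2 at *
  generalize arcDeriv x (curvature x) s = k1 at *
  generalize curvature x s = k at *
  generalize arcDeriv x (torsion x) s = t1 at *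
  generalize torsion x s = τ at *
  generalize arcDeriv x (arcDeriv x (curvVec x)) s = f4 at *
  generalize arcDeriv x (curvVec x) s = f3 at *
  generalize curvVec x s = f2 at *
  generalize tangent x s = f1 at *
  clear hP hPs hDP a11 a12 a13 ksq kD tsq c1 c2 c3 d1 d2 d3 kdiff knear kcont detdiff tdiff
  have I1 : det3 f1 f3 f4 * (k * k)
      = k * k1 * det3 f1 f2 f4 - inner ℝ f2 f4 * det3 f1 f2 f3 := by
    have g : det3 f1 f3 f4 * (inner ℝ f1 f1 * inner ℝ f2 f2 - inner ℝ f1 f2 * inner ℝ f1 f2)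
        - det3 f1 f2 f4 * (inner ℝ f1 f1 * inner ℝ f2 f3 - inner ℝ f1 f2 * inner ℝ f1 f3)
        + det3 f1 f2 f3 * (inner ℝ f1 f1 * inner ℝ f2 f4 - inner ℝ f1 f2 * inner ℝ f1 f4) = 0 := by
      simp only [det3_eq, inner_E3]
      ring
    rw [A11, A12, ← K0, ← K1] at g
    linarith
  have I2 : det3 f1 f2 f3 ^ 2 = k * k * (inner ℝ f3 f3 - (k * k) ^ 2) - (k * k1) ^ 2 := by
    have g : det3 f1 f2 f3 ^ 2 = inner ℝ f1 f1 * (inner ℝ f2 f2 * inner ℝ f3 f3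
        - inner ℝ f2 f3 ^ 2) - inner ℝ f1 f2 * (inner ℝ f1 f2 * inner ℝ f3 f3
        - inner ℝ f2 f3 * inner ℝ f1 f3) + inner ℝ f1 f3 * (inner ℝ f1 f2 * inner ℝ f2 f3
        - inner ℝ f2 f2 * inner ℝ f1 f3) := by
      simp only [det3_eq, inner_E3]
      ring
    rw [A11, A12, A13, ← K0, ← K1] at g
    linarith
  have N : det3 f1 ((1 : ℝ) • f3 + (k * k) • f1)
      ((0 : ℝ) • f3 + (1 : ℝ) • f4 + (w • f1 + (k * k) • f2))
      = det3 f1 f3 f4 - k * k * det3 f1 f2 f3 := by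
    simp only [det3_eq]
    simp
    ring
  have Q : (inner ℝ ((1 : ℝ) • f3 + (k * k) • f1) ((1 : ℝ) • f3 + (k * k) • f1) : ℝ)
      = inner ℝ f3 f3 - (k * k) ^ 2 := by
    have g : (inner ℝ ((1 : ℝ) • f3 + (k * k) • f1) ((1 : ℝ) • f3 + (k * k) • f1) : ℝ)
        = inner ℝ f3 f3 + 2 * (k * k) * inner ℝ f1 f3 + (k * k) ^ 2 * inner ℝ f1 f1 := by
      simp only [inner_E3, PiLp.add_apply, PiLp.smul_apply, smul_eq_mul]
      ring
    rw [g, A11, A13]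
    ring
  rw [N, Q]
  rw [← T0] at I1 I2
  rw [← tD] at I1
  have k2ne : k * k ≠ 0 := mul_ne_zero hk hk
  constructor
  · apply mul_left_cancel₀ k2ne
    linear_combination -I2
  · rw [← T0]
    apply mul_left_cancel₀ k2ne
    linear_combination I1 + (k * k * τ) * kDD - τ * I2

end ConformalCurve

end

open scoped ContDiff

noncomputable section

namespace ConformalCurve

/-! Let `P = normalThird x` be the normal part of `d³x/du³`. If `P` vanishes at a point, every
sphere through the osculating circle there has contact of order three (`hasContact_three`), so a
curve without vertices has an orthonormal frame: tangent, `m = P/|P|`, `q` = tangent × `m`. Let `σ`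
and `n` be the spheres through the osculating circle with normals `q` and `m`, and let `γ` be the
light-cone lift. Then (`isSphereFrame`) `σ' = w n` and `n' = -w σ + ρ γ`, where `ρ = |x'||P| > 0`
and the light-like `γ` is orthogonal to `σ` and `n`.

Successive differentiation shows that `σ` is orthogonal to `γ, γ', γ'', γ'''`, so `σ` is the
osculating sphere up to a global sign and `ω = |w| ds`; moreover `T dt = -w ds`. A zero of `w` would
give contact of order four, so `w` has constant sign. This yields `T ≠ 0` and the equality of the
two integrals, and leaves the bound `∫ |w| ≥ 2π` (`IsSphereFrame.two_pi_le_integral`).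

For the bound take `w > 0`, `Ω = ∫ w`, `v = γ(0)`, and suppose `Ω(p) < 2π`. The pair `f = ⟨σ, v⟩`,
`f₁ = ⟨n, v⟩` is an oscillator in the variable `Ω` with forcing `ρ⟨γ, v⟩ ≤ 0`, vanishing at both
ends; Sturm arguments from each end give `f < 0` in between. So `B = arctan (f₁/f)` is defined on
the open period and falls from `π/2` to `-π/2`, with `(Ω + B)' = κ ≥ 0`. The unit vector `E = -cos B
n + sin B σ` is orthogonal to `v` and moves with speed `κ` in `v^⊥`, where the form is semidefinite.
It runs from `σ(0)` to `-σ(0)`, antipodal points, so `∫ κ ≥ π`. But `∫ κ = Ω(p) - π`, whence `Ω(p) ≥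
2π`, a contradiction. -/

/-! ### Lorentz form and its restriction to the complement of a light-like vector. -/

lemma lor_comm (v w : L5) : lor v w = lor w v := by
  simp only [lor]
  ring

lemma lor_add_left (u v w : L5) : lor (u + v) w = lor u w + lor v w := by
  simp only [lor, Pi.add_apply]
  ring

lemma lor_smul_left (c : ℝ) (v w : L5) : lor (c • v) w = c * lor v w := by
  simp only [lor, Pi.smul_apply, smul_eq_mul]
  ring

lemma lor_add_right (u v w : L5) : lor u (v + w) = lor u v + lor u w := by
  simp only [lor, Pi.add_apply]
  ring

lemma lor_smul_right (c : ℝ) (v w : L5) : lor v (c • w) = c * lor v w := by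
  simp only [lor, Pi.smul_apply, smul_eq_mul]
  ring

lemma lor_neg_left (v w : L5) : lor (-v) w = -lor v w := by
  simp only [lor, Pi.neg_apply]
  ring

lemma lor_neg_right (v w : L5) : lor v (-w) = -lor v w := by
  rw [lor_comm, lor_neg_left, lor_comm]

lemma lor_lift_self (y : E3) : lor (lift y) (lift y) = 0 := by
  rw [lor_lift_lift]
  simp

lemma _root_.HasDerivAt.lor {a b : ℝ → L5} {a' b' : L5} {s : ℝ} (ha : HasDerivAt a a' s)
    (hb : HasDerivAt b b' s) :
    HasDerivAt (fun t => lor (a t) (b t)) (lor a' (b s) + lor (a s) b') s := by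
  have ha := hasDerivAt_pi.1 ha
  have hb := hasDerivAt_pi.1 hb
  have H := (((((ha 0).mul (hb 0)).add ((ha 1).mul (hb 1))).add ((ha 2).mul (hb 2))).add
    ((ha 3).mul (hb 3))).sub ((ha 4).mul (hb 4))
  refine H.congr_deriv ?_
  simp only [ConformalCurve.lor]
  ring

lemma _root_.HasDerivAt.lor_const {a : ℝ → L5} {a' : L5} {s : ℝ} (ha : HasDerivAt a a' s)
    (v : L5) : HasDerivAt (fun t => lor (a t) v) (lor a' v) s := by
  refine (ha.lor (hasDerivAt_const s v)).congr_deriv ?_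
  simp [ConformalCurve.lor]

/-- The Lorentz form is positive semidefinite on the orthogonal complement of a light-like
vector. -/
lemma lor_self_nonneg_of_orthogonal (y : E3) (a : L5) (h : lor (lift y) a = 0) :
    0 ≤ lor a a := by
  have h1 := lor_lift_self y
  have h4 : 0 < lift y 4 := by
    simp only [lift]
    simp
    positivity
  generalize lift y = v at *
  simp only [lor] at *
  -- Lagrange's identity for the spatial parts: `h1` replaces `v 4 ^ 2` by the spatial square of
  -- `v`, and `h` replaces `v 4 * a 4` by the spatial product.
  have key : v 4 * v 4 * (a 0 * a 0 + a 1 * a 1 + a 2 * a 2 + a 3 * a 3 - a 4 * a 4)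
      = (a 0 * v 1 - a 1 * v 0) ^ 2 + (a 0 * v 2 - a 2 * v 0) ^ 2 + (a 0 * v 3 - a 3 * v 0) ^ 2
        + (a 1 * v 2 - a 2 * v 1) ^ 2 + (a 1 * v 3 - a 3 * v 1) ^ 2
        + (a 2 * v 3 - a 3 * v 2) ^ 2 := by
    linear_combination (-(a 0 * a 0 + a 1 * a 1 + a 2 * a 2 + a 3 * a 3)) * h1
      + (v 0 * a 0 + v 1 * a 1 + v 2 * a 2 + v 3 * a 3 + v 4 * a 4) * h
  have h5 : 0 < v 4 * v 4 := mul_pos h4 h4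
  by_contra hneg
  have := mul_neg_of_pos_of_neg h5 (not_le.1 hneg)
  rw [key] at this
  have : 0 ≤ (a 0 * v 1 - a 1 * v 0) ^ 2 + (a 0 * v 2 - a 2 * v 0) ^ 2
    + (a 0 * v 3 - a 3 * v 0) ^ 2 + (a 1 * v 2 - a 2 * v 1) ^ 2 + (a 1 * v 3 - a 3 * v 1) ^ 2
    + (a 2 * v 3 - a 3 * v 2) ^ 2 := by positivity
  linarith

/-- Cauchy-Schwarz on the orthogonal complement of a light-like vector. -/
lemma lor_sq_le_of_orthogonal (y : E3) {a b : L5} (ha : lor (lift y) a = 0)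
    (hb : lor (lift y) b = 0) : lor a b ^ 2 ≤ lor a a * lor b b := by
  have h : ∀ t : ℝ, 0 ≤ lor b b * (t * t) + 2 * lor a b * t + lor a a := by
    intro t
    have := lor_self_nonneg_of_orthogonal y (a + t • b) (by
      rw [lor_add_right, lor_smul_right, ha, hb]; ring)
    simp only [lor_add_right, lor_smul_right, lor_add_left, lor_smul_left, lor_comm b a] at this
    linarith
  have := discrim_le_zero h
  simp only [discrim] at this
  nlinarith

/-- Bessel's inequality for a unit vector and a vector orthogonal to it. -/
lemma lor_bessel (y : E3) {u e z : L5} (hu : lor (lift y) u = 0)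
    (he : lor (lift y) e = 0) (hz : lor (lift y) z = 0) (huu : lor u u = 1) (hee : lor e e = 1)
    (hze : lor z e = 0) : lor z u ^ 2 ≤ lor z z * (1 - lor e u ^ 2) := by
  -- Cauchy-Schwarz for `z` against the component of `u` orthogonal to `e`.
  have h := lor_sq_le_of_orthogonal y hz
    (b := u + (-lor e u) • e) (by rw [lor_add_right, lor_smul_right, hu, he]; ring)
  simp only [lor_add_right, lor_smul_right, lor_add_left, lor_smul_left, lor_comm u e, hze, hee,
    huu] at h
  nlinarith

/-- A path `σ` of spheres with unit normal velocity `n` whose geodesic curvature vector is a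
future-pointing multiple of the light-like vector `lift (x s)`. -/
structure IsSphereFrame (x : ℝ → E3) (σ n : ℝ → L5) (w ρ : ℝ → ℝ) : Prop where
  hasDerivAt_sphere : ∀ s, HasDerivAt σ (w s • n s) s
  hasDerivAt_normal : ∀ s, HasDerivAt n (-w s • σ s + ρ s • lift (x s)) s
  sphere_sphere : ∀ s, lor (σ s) (σ s) = 1
  normal_normal : ∀ s, lor (n s) (n s) = 1
  sphere_normal : ∀ s, lor (σ s) (n s) = 0
  lift_sphere : ∀ s, lor (lift (x s)) (σ s) = 0
  lift_normal : ∀ s, lor (lift (x s)) (n s) = 0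

/-- Reversing the orientation of `σ` alone flips the sign of `w` but not of `ρ`, so a bound proved
for `w > 0` also covers `w < 0`. -/
lemma IsSphereFrame.neg {x : ℝ → E3} {σ n : ℝ → L5} {w ρ : ℝ → ℝ}
    (h : IsSphereFrame x σ n w ρ) : IsSphereFrame x (-σ) n (-w) ρ where
  hasDerivAt_sphere s := (h.hasDerivAt_sphere s).neg.congr_deriv (by simp)
  hasDerivAt_normal s := (h.hasDerivAt_normal s).congr_deriv (by simp)
  sphere_sphere s := by simp [lor_neg_left, lor_neg_right, h.sphere_sphere]
  normal_normal := h.normal_normal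
  sphere_normal s := by simp [lor_neg_left, h.sphere_normal]
  lift_sphere s := by simp [lor_neg_right, h.lift_sphere]
  lift_normal := h.lift_normal

/-! ### Sturm comparison for a forced oscillator. -/

section Sturm

variable {f f₁ g w Ω : ℝ → ℝ}

/-- Rotating by `α - Ω` undoes the free motion of the oscillator, so only the forcing survives. -/
lemma hasDerivAt_rotated {s : ℝ} (hf : HasDerivAt f (w s * f₁ s) s)
    (hf₁ : HasDerivAt f₁ (-w s * f s + g s) s) (hΩ : HasDerivAt Ω (w s) s) (α : ℝ) :
    HasDerivAt (fun r => f r * Real.cos (α - Ω r) + f₁ r * Real.sin (α - Ω r))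
      (g s * Real.sin (α - Ω s)) s := by
  have h := hΩ.const_sub α
  refine ((hf.mul h.cos).add (hf₁.mul h.sin)).congr_deriv ?_
  ring

/-- Variation of constants: `f s` is the integral of `g r * sin (Ω s - Ω r)` from `a` to `s`, and
this kernel is positive as long as `Ω` has advanced by at most a half turn. -/
lemma neg_of_initial_zero (hf : ∀ s, HasDerivAt f (w s * f₁ s) s)
    (hf₁ : ∀ s, HasDerivAt f₁ (-w s * f s + g s) s) (hΩ : ∀ s, HasDerivAt Ω (w s) s)
    (hw : ∀ s, 0 < w s) (hg : ∀ s, g s ≤ 0) {a s : ℝ} (ha : f a = 0) (ha₁ : f₁ a = 0)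
    (has : a < s) (hlen : Ω s - Ω a ≤ Real.pi) (hneg : ∃ r ∈ Set.Ioo a s, g r < 0) :
    f s < 0 := by
  have hmono : StrictMono Ω := strictMono_of_deriv_pos fun r => by rw [(hΩ r).deriv]; exact hw r
  set H : ℝ → ℝ := fun r => f r * Real.cos (Ω s - Ω r) + f₁ r * Real.sin (Ω s - Ω r) with hH
  have hd : ∀ r, HasDerivAt H (g r * Real.sin (Ω s - Ω r)) r := fun r =>
    hasDerivAt_rotated (hf r) (hf₁ r) (hΩ r) _
  have hc : Continuous H := continuous_iff_continuousAt.2 fun r => (hd r).continuousAt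
  have hsin : ∀ r ∈ Set.Ioo a s, 0 < Real.sin (Ω s - Ω r) := by
    intro r hr
    have h1 := hmono hr.1
    have h2 := hmono hr.2
    exact Real.sin_pos_of_pos_of_lt_pi (by linarith) (by linarith)
  have hanti : AntitoneOn H (Set.Icc a s) := by
    refine antitoneOn_of_deriv_nonpos (convex_Icc a s) hc.continuousOn
      (fun r _ => (hd r).differentiableAt.differentiableWithinAt) fun r hr => ?_
    rw [interior_Icc] at hr
    rw [(hd r).deriv]
    exact mul_nonpos_of_nonpos_of_nonneg (hg r) (hsin r hr).le
  have Ha : H a = 0 := by simp [hH, ha, ha₁]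
  have Hs : H s = f s := by simp [hH]
  have hle : ∀ r ∈ Set.Icc a s, H r ≤ 0 := fun r hr => by
    rw [← Ha]; exact hanti (Set.left_mem_Icc.2 has.le) hr hr.1
  -- If `f s = 0`, the antitone `H` is identically zero on the interval, so its derivative vanishes
  -- even where `g < 0`.
  refine lt_of_le_of_ne (Hs ▸ hle s (Set.right_mem_Icc.2 has.le)) fun h0 => ?_
  obtain ⟨r, hr, hgr⟩ := hneg
  have hzero : ∀ q ∈ Set.Ioo a s, H q = 0 := fun q hq =>
    le_antisymm (hle q ⟨hq.1.le, hq.2.le⟩) (by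
      rw [← h0, ← Hs]
      exact hanti ⟨hq.1.le, hq.2.le⟩ (Set.right_mem_Icc.2 has.le) hq.2.le)
  have he : H =ᶠ[nhds r] fun _ => (0 : ℝ) := by
    filter_upwards [Ioo_mem_nhds hr.1 hr.2] with q hq using hzero q hq
  have := he.deriv_eq
  rw [(hd r).deriv, deriv_const] at this
  exact (mul_neg_of_neg_of_pos hgr (hsin r hr)).ne this

/-- Time reversal of `neg_of_initial_zero`; the velocity component `f₁` changes sign. -/
lemma neg_of_terminal_zero (hf : ∀ s, HasDerivAt f (w s * f₁ s) s)
    (hf₁ : ∀ s, HasDerivAt f₁ (-w s * f s + g s) s) (hΩ : ∀ s, HasDerivAt Ω (w s) s)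
    (hw : ∀ s, 0 < w s) (hg : ∀ s, g s ≤ 0) {b s : ℝ} (hb : f b = 0) (hb₁ : f₁ b = 0)
    (hsb : s < b) (hlen : Ω b - Ω s ≤ Real.pi) (hneg : ∃ r ∈ Set.Ioo s b, g r < 0) :
    f s < 0 := by
  have key := neg_of_initial_zero (f := fun r => f (-r)) (f₁ := fun r => -f₁ (-r))
    (g := fun r => g (-r)) (w := fun r => w (-r)) (Ω := fun r => -Ω (-r)) (a := -b) (s := -s)
    (fun r => by
      refine ((hf (-r)).comp r (hasDerivAt_neg r)).congr_deriv ?_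
      ring)
    (fun r => by
      refine ((hf₁ (-r)).comp r (hasDerivAt_neg r)).neg.congr_deriv ?_
      ring)
    (fun r => by
      refine ((hΩ (-r)).comp r (hasDerivAt_neg r)).neg.congr_deriv ?_
      ring)
    (fun r => hw _) (fun r => hg _) (by simpa using hb) (by simpa using hb₁) (by linarith)
    (by simp; linarith) (by
      obtain ⟨r, hr, h⟩ := hneg
      exact ⟨-r, ⟨by linarith [hr.2], by linarith [hr.1]⟩, by simpa using h⟩)
  simpa using key

/-- Both `f` and `f₁` vanish at `a`, so the limit of `f₁ / f` there is indeterminate; this bound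
pins it down. With the rotation based at `a` one gets `f cos θ - f₁ sin θ ≥ 0` for `θ = Ω s - Ω a`,
and dividing by `f sin θ < 0` gives `f₁ / f ≥ cot θ`. -/
lemma arctan_ge_of_initial_zero (hf : ∀ s, HasDerivAt f (w s * f₁ s) s)
    (hf₁ : ∀ s, HasDerivAt f₁ (-w s * f s + g s) s) (hΩ : ∀ s, HasDerivAt Ω (w s) s)
    (hw : ∀ s, 0 < w s) (hg : ∀ s, g s ≤ 0) {a s : ℝ} (ha : f a = 0) (ha₁ : f₁ a = 0)
    (has : a < s) (hlen : Ω s - Ω a < Real.pi) (hneg : f s < 0) :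
    Real.pi / 2 - (Ω s - Ω a) ≤ Real.arctan (f₁ s / f s) := by
  have hmono : StrictMono Ω := strictMono_of_deriv_pos fun r => by rw [(hΩ r).deriv]; exact hw r
  set H : ℝ → ℝ := fun r => f r * Real.cos (Ω a - Ω r) + f₁ r * Real.sin (Ω a - Ω r) with hH
  have hd : ∀ r, HasDerivAt H (g r * Real.sin (Ω a - Ω r)) r := fun r =>
    hasDerivAt_rotated (hf r) (hf₁ r) (hΩ r) _
  have hc : Continuous H := continuous_iff_continuousAt.2 fun r => (hd r).continuousAt
  have hm : MonotoneOn H (Set.Icc a s) := by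
    refine monotoneOn_of_deriv_nonneg (convex_Icc a s) hc.continuousOn
      (fun r _ => (hd r).differentiableAt.differentiableWithinAt) fun r hr => ?_
    rw [interior_Icc] at hr
    rw [(hd r).deriv]
    have h1 := hmono hr.1
    have h2 := hmono hr.2
    exact mul_nonneg_of_nonpos_of_nonpos (hg r)
      (Real.sin_nonpos_of_nonpos_of_neg_pi_le (by linarith) (by linarith))
  have h0 : 0 ≤ f s * Real.cos (Ω s - Ω a) - f₁ s * Real.sin (Ω s - Ω a) := by
    have := hm (Set.left_mem_Icc.2 has.le) (Set.right_mem_Icc.2 has.le) has.le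
    have e1 : Real.cos (Ω a - Ω s) = Real.cos (Ω s - Ω a) := by rw [← Real.cos_neg, neg_sub]
    have e2 : Real.sin (Ω a - Ω s) = -Real.sin (Ω s - Ω a) := by rw [← Real.sin_neg, neg_sub]
    simp only [hH, ha, ha₁, e1, e2] at this
    linarith
  have hsin : 0 < Real.sin (Ω s - Ω a) :=
    Real.sin_pos_of_pos_of_lt_pi (by linarith [hmono has]) hlen
  have hle : Real.tan (Real.pi / 2 - (Ω s - Ω a)) ≤ f₁ s / f s := by
    rw [Real.tan_eq_sin_div_cos, Real.sin_pi_div_two_sub, Real.cos_pi_div_two_sub,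
      div_le_iff₀ hsin, div_mul_eq_mul_div, le_div_iff_of_neg hneg]
    linarith
  rw [← Real.arctan_tan (x := Real.pi / 2 - (Ω s - Ω a)) (by linarith) (by linarith [hmono has])]
  exact Real.arctan_mono hle

lemma arctan_le_of_terminal_zero (hf : ∀ s, HasDerivAt f (w s * f₁ s) s)
    (hf₁ : ∀ s, HasDerivAt f₁ (-w s * f s + g s) s) (hΩ : ∀ s, HasDerivAt Ω (w s) s)
    (hw : ∀ s, 0 < w s) (hg : ∀ s, g s ≤ 0) {b s : ℝ} (hb : f b = 0) (hb₁ : f₁ b = 0)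
    (hsb : s < b) (hlen : Ω b - Ω s < Real.pi) (hneg : f s < 0) :
    Real.arctan (f₁ s / f s) ≤ -(Real.pi / 2 - (Ω b - Ω s)) := by
  have key := arctan_ge_of_initial_zero (f := fun r => f (-r)) (f₁ := fun r => -f₁ (-r))
    (g := fun r => g (-r)) (w := fun r => w (-r)) (Ω := fun r => -Ω (-r)) (a := -b) (s := -s)
    (fun r => by
      refine ((hf (-r)).comp r (hasDerivAt_neg r)).congr_deriv ?_
      ring)
    (fun r => by
      refine ((hf₁ (-r)).comp r (hasDerivAt_neg r)).neg.congr_deriv ?_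
      ring)
    (fun r => by
      refine ((hΩ (-r)).comp r (hasDerivAt_neg r)).neg.congr_deriv ?_
      ring)
    (fun r => hw _) (fun r => hg _) (by simpa using hb) (by simpa using hb₁) (by linarith)
    (by simp; linarith) (by simpa using hneg)
  simp only [neg_neg, neg_div, Real.arctan_neg] at key
  linarith

end Sturm

/-! ### Length of closed sphere frames. -/

lemma lor_lift_lift_nonpos (y z : E3) : lor (lift y) (lift z) ≤ 0 := by
  rw [lor_lift_lift]
  have := sq_nonneg ‖y - z‖
  linarith

/-- The angle `arcsin c` changes at rate at most `κ`. The factor `l < 1` keeps the argument away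
from `±1`, where `arcsin` is not differentiable; the estimate survives because `l² (1 - c²) ≤ 1 - l²
c²`. -/
lemma exists_hasDerivAt_add_arcsin {Φ c : ℝ → ℝ} {κ c' s l : ℝ} (hΦ : HasDerivAt Φ κ s)
    (hc : HasDerivAt c c' s) (hκ : 0 ≤ κ) (hc1 : c s ^ 2 ≤ 1)
    (hc' : c' ^ 2 ≤ κ ^ 2 * (1 - c s ^ 2)) (hl0 : 0 ≤ l) (hl1 : l < 1) :
    ∃ d, 0 ≤ d ∧ HasDerivAt (fun t => Φ t + Real.arcsin (l * c t)) d s := by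
  have hl2 : l ^ 2 < 1 := pow_lt_one₀ hl0 hl1 two_ne_zero
  have hlc : (l * c s) ^ 2 < 1 := by
    rw [mul_pow]
    exact (mul_le_of_le_one_right (sq_nonneg l) hc1).trans_lt hl2
  have habs := abs_lt.1 ((sq_lt_one_iff_abs_lt_one _).1 hlc)
  have Darc := (Real.hasDerivAt_arcsin habs.1.ne' habs.2.ne).comp s (hc.const_mul l)
  refine ⟨_, ?_, hΦ.add Darc⟩
  have hpos : 0 < Real.sqrt (1 - (l * c s) ^ 2) := Real.sqrt_pos.2 (by linarith)
  have hbound : -(l * c') ≤ κ * Real.sqrt (1 - (l * c s) ^ 2) := by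
    refine (neg_le_abs _).trans (abs_le_of_sq_le_sq ?_ (by positivity))
    rw [mul_pow, mul_pow κ, Real.sq_sqrt (by linarith), mul_pow]
    have h1 : l ^ 2 * c' ^ 2 ≤ l ^ 2 * (κ ^ 2 * (1 - c s ^ 2)) :=
      mul_le_mul_of_nonneg_left hc' (sq_nonneg l)
    have h2 : 0 ≤ κ ^ 2 * (1 - l ^ 2) := mul_nonneg (sq_nonneg _) (by linarith)
    linarith
  have : -κ ≤ 1 / Real.sqrt (1 - (l * c s) ^ 2) * (l * c') := by
    rw [one_div, inv_mul_eq_div, le_div_iff₀ hpos]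
    linarith
  linarith

section Frame

variable {x : ℝ → E3} {σ n : ℝ → L5} {w ρ : ℝ → ℝ}

/-- The angle of the pair `(⟨σ, v⟩, ⟨n, v⟩)`, up to a half turn. -/
def pencilAngle (σ n : ℝ → L5) (v : L5) (s : ℝ) : ℝ :=
  Real.arctan (lor (n s) v / lor (σ s) v)

/-- The product with `u` of the unit vector orthogonal to `v` in the pencil spanned by the sphere
and its normal. -/
def pencilProj (σ n : ℝ → L5) (v u : L5) (s : ℝ) : ℝ :=
  -Real.cos (pencilAngle σ n v s) * lor (n s) u + Real.sin (pencilAngle σ n v s) * lor (σ s) u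

/-- `Ω + B` grows at rate `κ`, which is also the speed of the unit vector `E` of the pencil
orthogonal to `lift y`. The product `c = ⟨E, u⟩` is the cosine of an angle on a sphere, and that
angle cannot change faster than `E` moves. -/
lemma IsSphereFrame.hasDerivAt_arcsin_add (h : IsSphereFrame x σ n w ρ) (hρ : ∀ s, 0 < ρ s)
    {Ω : ℝ → ℝ} (hΩ : ∀ s, HasDerivAt Ω (w s) s) {y : E3} {u : L5} (hu : lor (lift y) u = 0)
    (huu : lor u u = 1) {s l : ℝ} (hf : lor (σ s) (lift y) < 0) (hl0 : 0 ≤ l) (hl1 : l < 1) :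
    ∃ d, 0 ≤ d ∧ HasDerivAt (fun t => Ω t + pencilAngle σ n (lift y) t
      + Real.arcsin (l * pencilProj σ n (lift y) u t)) d s := by
  set B := pencilAngle σ n (lift y)
  set c := pencilProj σ n (lift y) u
  have Df := (h.hasDerivAt_sphere s).lor_const (lift y)
  have Df₁ := (h.hasDerivAt_normal s).lor_const (lift y)
  have Du := (h.hasDerivAt_sphere s).lor_const u
  have Du₁ := (h.hasDerivAt_normal s).lor_const u
  have DB := (Df₁.div Df hf.ne).arctan
  have hg : ρ s * lor (lift (x s)) (lift y) ≤ 0 :=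
    mul_nonpos_of_nonneg_of_nonpos (hρ s).le (lor_lift_lift_nonpos _ _)
  simp only [lor_add_left, lor_smul_left] at Df Df₁ Du Du₁ DB
  have hC : 0 < Real.cos (B s) := Real.cos_arctan_pos _
  have hCS := Real.sin_sq_add_cos_sq (B s)
  have htan : Real.cos (B s) * lor (n s) (lift y) = Real.sin (B s) * lor (σ s) (lift y) := by
    have : Real.tan (B s) = lor (n s) (lift y) / lor (σ s) (lift y) := Real.tan_arctan _
    rw [Real.tan_eq_sin_div_cos, div_eq_div_iff hC.ne' hf.ne] at this
    linarith
  set f := lor (σ s) (lift y) with hfdef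
  set f₁ := lor (n s) (lift y) with hf₁def
  set g := ρ s * lor (lift (x s)) (lift y) with hgdef
  set C := Real.cos (B s) with hCdef
  set S := Real.sin (B s) with hSdef
  set κ := g * C ^ 2 / f
  have hκ : 0 ≤ κ := div_nonneg_of_nonpos (mul_nonpos_of_nonpos_of_nonneg hg (sq_nonneg _)) hf.le
  have hκf : κ * f = g * C ^ 2 := div_mul_cancel₀ _ hf.ne
  have hsq : (f ^ 2 + f₁ ^ 2) * C ^ 2 = f ^ 2 := by
    linear_combination f ^ 2 * hCS + (C * f₁ + S * f) * htan
  have DB' : HasDerivAt B (-w s + κ) s := by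
    refine DB.congr_deriv ?_
    have h1 : 1 + (f₁ / f) ^ 2 = (f ^ 2 + f₁ ^ 2) / f ^ 2 := by
      field_simp [hf.ne]
    have h2 : f ^ 2 + f₁ ^ 2 ≠ 0 := by
      have := pow_pos (neg_pos.2 hf) 2
      nlinarith [sq_nonneg f₁]
    change 1 / (1 + (f₁ / f) ^ 2) * _ = _
    have hκ2 : κ * (f ^ 2 + f₁ ^ 2) = g * f := by
      apply mul_left_cancel₀ hf.ne
      linear_combination (f ^ 2 + f₁ ^ 2) * hκf + g * hsq
    rw [h1, one_div_div, mul_comm, div_mul_div_cancel₀ (pow_ne_zero 2 hf.ne), div_eq_iff h2]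
    linear_combination -hκ2
  have Dc : HasDerivAt c (κ * (S * lor (n s) u + C * lor (σ s) u)
      - ρ s * C * lor (lift (x s)) u) s := by
    refine ((DB'.cos.neg.mul Du₁).add (DB'.sin.mul Du)).congr_deriv ?_
    simp only [← hCdef, ← hSdef, Pi.neg_apply]
    ring
  -- `Z` is the derivative of `E` along the path. Its light-like part is orthogonal to `σ` and `n`,
  -- so it does not contribute to `⟨Z, Z⟩ = κ²`.
  set Z : L5 := κ • (S • n s + C • σ s) + (-(ρ s * C)) • lift (x s) with hZ
  set E : L5 := (-C) • n s + S • σ s with hE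
  have ss := h.sphere_sphere s
  have nn := h.normal_normal s
  have sn := h.sphere_normal s
  have ls := h.lift_sphere s
  have ln := h.lift_normal s
  have ll := lor_lift_self (x s)
  have Zu : lor Z u = κ * (S * lor (n s) u + C * lor (σ s) u)
      - ρ s * C * lor (lift (x s)) u := by
    simp only [hZ, lor_add_left, lor_smul_left]
    ring
  have Eu : lor E u = c s := by
    simp only [hE, lor_add_left, lor_smul_left]
    rfl
  have ZZ : lor Z Z = κ ^ 2 := by
    simp only [hZ, lor_add_left, lor_smul_left, lor_add_right, lor_smul_right,
      lor_comm _ (lift (x s)), lor_comm (n s) (σ s), ss, nn, sn, ls, ln, ll]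
    linear_combination κ ^ 2 * hCS
  have ZE : lor Z E = 0 := by
    simp only [hZ, hE, lor_add_left, lor_smul_left, lor_add_right, lor_smul_right,
      lor_comm (n s) (σ s), ss, nn, sn, ls, ln]
    ring
  have EE : lor E E = 1 := by
    simp only [hE, lor_add_left, lor_smul_left, lor_add_right, lor_smul_right,
      lor_comm (n s) (σ s), ss, nn, sn]
    linear_combination hCS
  have vE : lor (lift y) E = 0 := by
    rw [lor_comm]
    simp only [hE, lor_add_left, lor_smul_left, ← hfdef, ← hf₁def]
    linarith
  have vZ : lor (lift y) Z = 0 := by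
    rw [lor_comm]
    simp only [hZ, lor_add_left, lor_smul_left, ← hfdef, ← hf₁def]
    have : κ * (S * f₁ + C * f) - C * g = 0 := by
      apply mul_left_cancel₀ hC.ne'
      linear_combination κ * S * htan + κ * f * hCS + hκf
    rw [hgdef] at this
    linarith
  have bessel := lor_bessel y hu vE vZ huu EE ZE
  have hc1 : c s ^ 2 ≤ 1 := by
    have := lor_sq_le_of_orthogonal y vE hu
    rwa [EE, huu, Eu, one_mul] at this
  rw [Zu, ZZ, Eu] at bessel
  exact exists_hasDerivAt_add_arcsin (((hΩ s).add DB').congr_deriv (by ring)) Dc hκ hc1 bessel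
    hl0 hl1

/-- A closed path of spheres with future-pointing light-like geodesic curvature vector has length
at least `2π`. -/
theorem IsSphereFrame.two_pi_le_integral (h : IsSphereFrame x σ n w ρ) (hw : Continuous w)
    (hw0 : ∀ s, 0 < w s) (hρ : ∀ s, 0 < ρ s) {p : ℝ} (hp : 0 < p) (hσp : σ p = σ 0)
    (hnp : n p = n 0) (hx : ∀ a b, a < b → ∃ r ∈ Set.Ioo a b, x r ≠ x 0) :
    2 * Real.pi ≤ ∫ s in (0 : ℝ)..p, w s := by
  set Ω : ℝ → ℝ := fun s => ∫ t in (0 : ℝ)..s, w t with hΩdef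
  have hΩ : ∀ s, HasDerivAt Ω (w s) s := fun s => (hw.integral_hasStrictDerivAt 0 s).hasDerivAt
  have hΩ0 : Ω 0 = 0 := by simp [hΩdef]
  have hΩc : Continuous Ω := continuous_iff_continuousAt.2 fun r => (hΩ r).continuousAt
  change 2 * Real.pi ≤ Ω p
  by_contra! hlt
  set v := lift (x 0) with hv
  set u := σ 0 with hu
  have Df : ∀ s, HasDerivAt (fun t => lor (σ t) v) (w s * lor (n s) v) s := fun s =>
    ((h.hasDerivAt_sphere s).lor_const v).congr_deriv (lor_smul_left _ _ _)
  have Df₁ : ∀ s, HasDerivAt (fun t => lor (n t) v)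
      (-w s * lor (σ s) v + ρ s * lor (lift (x s)) v) s := fun s =>
    ((h.hasDerivAt_normal s).lor_const v).congr_deriv (by
      rw [lor_add_left, lor_smul_left, lor_smul_left])
  have hg : ∀ s, ρ s * lor (lift (x s)) v ≤ 0 := fun s =>
    mul_nonpos_of_nonneg_of_nonpos (hρ s).le (lor_lift_lift_nonpos _ _)
  have hgneg : ∀ a b, a < b → ∃ r ∈ Set.Ioo a b, ρ r * lor (lift (x r)) v < 0 := by
    intro a b hab
    obtain ⟨r, hr, hne⟩ := hx a b hab
    refine ⟨r, hr, mul_neg_of_pos_of_neg (hρ r) ?_⟩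
    rw [hv, lor_lift_lift]
    have := pow_pos (norm_pos_iff.2 (sub_ne_zero.2 hne)) 2
    linarith
  have f0 : lor (σ 0) v = 0 := by rw [lor_comm]; exact h.lift_sphere 0
  have f₁0 : lor (n 0) v = 0 := by rw [lor_comm]; exact h.lift_normal 0
  have fp : lor (σ p) v = 0 := by rw [hσp]; exact f0
  have f₁p : lor (n p) v = 0 := by rw [hnp]; exact f₁0
  -- As `Ω p < 2π`, every point is within a half turn of one of the two ends.
  have hneg : ∀ s ∈ Set.Ioo 0 p, lor (σ s) v < 0 := by
    intro s hs
    rcases le_total (Ω s) Real.pi with hle | hle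
    · exact neg_of_initial_zero Df Df₁ hΩ hw0 hg f0 f₁0 hs.1 (by linarith) (hgneg _ _ hs.1)
    · exact neg_of_terminal_zero Df Df₁ hΩ hw0 hg fp f₁p hs.2 (by linarith) (hgneg _ _ hs.2)
  set B := pencilAngle σ n v
  set c := pencilProj σ n v u
  have cσ : Continuous σ := continuous_iff_continuousAt.2 fun r =>
    (h.hasDerivAt_sphere r).continuousAt
  have tΩ0 : Filter.Tendsto Ω (nhdsWithin 0 (Set.Ioi 0)) (nhds 0) := by
    have := hΩc.tendsto 0
    rw [hΩ0] at this
    exact this.mono_left nhdsWithin_le_nhds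
  have tΩp : Filter.Tendsto Ω (nhdsWithin p (Set.Iio p)) (nhds (Ω p)) :=
    (hΩc.tendsto p).mono_left nhdsWithin_le_nhds
  have e0 : ∀ᶠ s in nhdsWithin 0 (Set.Ioi 0), s ∈ Set.Ioo 0 p := Ioo_mem_nhdsGT hp
  have ep : ∀ᶠ s in nhdsWithin p (Set.Iio p), s ∈ Set.Ioo 0 p := Ioo_mem_nhdsLT hp
  -- Squeezed between the Sturm bound `π/2 - Ω` and the upper bound `π/2` of `arctan`.
  have tB0 : Filter.Tendsto B (nhdsWithin 0 (Set.Ioi 0)) (nhds (Real.pi / 2)) := by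
    have h1 : Filter.Tendsto (fun s => Real.pi / 2 - Ω s) (nhdsWithin 0 (Set.Ioi 0))
        (nhds (Real.pi / 2)) := by simpa using tΩ0.const_sub (Real.pi / 2)
    refine tendsto_of_tendsto_of_tendsto_of_le_of_le' h1 tendsto_const_nhds ?_
      (Filter.Eventually.of_forall fun s => (Real.arctan_lt_pi_div_two _).le)
    filter_upwards [e0, tΩ0.eventually (gt_mem_nhds Real.pi_pos)] with s hs hπ
    have := arctan_ge_of_initial_zero Df Df₁ hΩ hw0 hg f0 f₁0 hs.1 (by linarith) (hneg s hs)
    rwa [hΩ0, sub_zero] at this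
  have tBp : Filter.Tendsto B (nhdsWithin p (Set.Iio p)) (nhds (-(Real.pi / 2))) := by
    have h1 : Filter.Tendsto (fun s => -(Real.pi / 2 - (Ω p - Ω s))) (nhdsWithin p (Set.Iio p))
        (nhds (-(Real.pi / 2))) := by
      simpa using ((tΩp.const_sub (Ω p)).const_sub (Real.pi / 2)).neg
    refine tendsto_of_tendsto_of_tendsto_of_le_of_le' tendsto_const_nhds h1
      (Filter.Eventually.of_forall fun s => (Real.neg_pi_div_two_lt_arctan _).le) ?_
    filter_upwards [ep, tΩp.eventually (lt_mem_nhds (sub_lt_self (Ω p) Real.pi_pos))] with s hs hπ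
    exact arctan_le_of_terminal_zero Df Df₁ hΩ hw0 hg fp f₁p hs.2 (by linarith) (hneg s hs)
  have cu : ∀ (τ : ℝ → L5), Continuous τ → Continuous fun s => lor (τ s) u := by
    intro τ hτ
    simp only [lor]
    fun_prop
  have cn : Continuous n := continuous_iff_continuousAt.2 fun r =>
    (h.hasDerivAt_normal r).continuousAt
  have uu : lor u u = 1 := h.sphere_sphere 0
  have nu : lor (n 0) u = 0 := by rw [lor_comm]; exact h.sphere_normal 0
  have tc : ∀ {a β : ℝ} {s : Set ℝ}, Filter.Tendsto B (nhdsWithin a s) (nhds β) →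
      Filter.Tendsto c (nhdsWithin a s)
        (nhds (-Real.cos β * lor (n a) u + Real.sin β * lor (σ a) u)) := by
    intro a β s ht
    exact (((Real.continuous_cos.tendsto β).comp ht).neg.mul
      (((cu n cn).tendsto a).mono_left nhdsWithin_le_nhds)).add
      (((Real.continuous_sin.tendsto β).comp ht).mul
      (((cu σ cσ).tendsto a).mono_left nhdsWithin_le_nhds))
  have tc0 : Filter.Tendsto c (nhdsWithin 0 (Set.Ioi 0)) (nhds 1) := by
    have := tc tB0
    rw [← hu, uu, nu] at this
    simpa using this
  have tcp : Filter.Tendsto c (nhdsWithin p (Set.Iio p)) (nhds (-1)) := by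
    have := tc tBp
    rw [hσp, hnp, uu, nu] at this
    simpa using this
  -- The monotone function `Ω + B + arcsin (l c)` tends to `π/2 + arcsin l` at `0` and to `Ω p - π/2
  -- - arcsin l` at `p`.
  have key : ∀ l ∈ Set.Ico (0 : ℝ) 1, Real.pi + 2 * Real.arcsin l ≤ Ω p := by
    intro l hl
    set Φ : ℝ → ℝ := fun t => Ω t + B t + Real.arcsin (l * c t)
    have hd : ∀ s ∈ Set.Ioo 0 p, ∃ d, 0 ≤ d ∧ HasDerivAt Φ d s := fun s hs =>
      h.hasDerivAt_arcsin_add hρ hΩ (h.lift_sphere 0) uu (hneg s hs) hl.1 hl.2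
    have hdiff : DifferentiableOn ℝ Φ (Set.Ioo 0 p) := fun s hs => by
      obtain ⟨d, -, hd⟩ := hd s hs
      exact hd.differentiableAt.differentiableWithinAt
    have hm : MonotoneOn Φ (Set.Ioo 0 p) := by
      refine monotoneOn_of_deriv_nonneg (convex_Ioo 0 p) hdiff.continuousOn
        (hdiff.mono interior_subset) fun s hs => ?_
      rw [interior_Ioo] at hs
      obtain ⟨d, hd0, hd⟩ := hd s hs
      rwa [hd.deriv]
    have t0 : Filter.Tendsto Φ (nhdsWithin 0 (Set.Ioi 0))
        (nhds (0 + Real.pi / 2 + Real.arcsin (l * 1))) :=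
      (tΩ0.add tB0).add ((Real.continuous_arcsin.tendsto _).comp (tc0.const_mul l))
    have tp : Filter.Tendsto Φ (nhdsWithin p (Set.Iio p))
        (nhds (Ω p + -(Real.pi / 2) + Real.arcsin (l * -1))) :=
      (tΩp.add tBp).add ((Real.continuous_arcsin.tendsto _).comp (tcp.const_mul l))
    have step : ∀ b ∈ Set.Ioo 0 p, 0 + Real.pi / 2 + Real.arcsin (l * 1) ≤ Φ b := by
      intro b hb
      refine le_of_tendsto t0 ?_
      filter_upwards [Ioo_mem_nhdsGT hb.1] with a ha
      exact hm ⟨ha.1, ha.2.trans hb.2⟩ hb ha.2.le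
    have := ge_of_tendsto tp (ep.mono step)
    rw [mul_neg, mul_one, Real.arcsin_neg] at this
    linarith
  have tl : Filter.Tendsto (fun l => Real.pi + 2 * Real.arcsin l) (nhdsWithin 1 (Set.Iio 1))
      (nhds (Real.pi + 2 * Real.arcsin 1)) :=
    (((Real.continuous_arcsin.tendsto 1).const_mul 2).const_add _).mono_left nhdsWithin_le_nhds
  have := le_of_tendsto tl (by
    filter_upwards [Ico_mem_nhdsLT (zero_lt_one' ℝ)] with l hl using key l hl)
  rw [Real.arcsin_one] at this
  linarith

end Frame

/-! ### Spheres through a given point, and cross products. -/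

/-- The vector `d_y lift (a) + c lift y` orthogonal to `lift y`: if `a` is a unit vector, the
sphere through `y` with normal `a` and signed curvature `c`. -/
def sphereAt (y a : E3) (c : ℝ) : L5 :=
  ![a 0, a 1, a 2, inner ℝ y a, inner ℝ y a] + c • lift y

lemma sphereAt_apply (y a : E3) (c : ℝ) (i : Fin 5) : sphereAt y a c i
    = (![a 0, a 1, a 2, inner ℝ y a, inner ℝ y a] : L5) i + c * lift y i := rfl

lemma lor_lift_sphereAt (z y a : E3) (c : ℝ) :
    lor (lift z) (sphereAt y a c) = inner ℝ (z - y) a - c * ‖z - y‖ ^ 2 / 2 := by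
  simp only [sphereAt, lor_add_right, lor_smul_right, lor_lift_lift]
  simp only [lor, lift, inner_E3, PiLp.sub_apply]
  simp
  ring

lemma lor_lift_sphereAt_self (y a : E3) (c : ℝ) : lor (lift y) (sphereAt y a c) = 0 := by
  simp [lor_lift_sphereAt]

/-- The curvatures multiply `lift y`, which is light-like and orthogonal to both vectors, so only
the normals count. -/
lemma lor_sphereAt (y a b : E3) (c d : ℝ) :
    lor (sphereAt y a c) (sphereAt y b d) = inner ℝ a b := by
  rw [sphereAt.eq_def y b, lor_add_right, lor_smul_right, lor_comm _ (lift y),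
    lor_lift_sphereAt_self, sphereAt, lor_add_left, lor_smul_left]
  simp only [lor, lift, inner_E3]
  simp
  ring_nf
  simp

lemma sphereAt_smul (y a : E3) (c l : ℝ) : sphereAt y (l • a) (l * c) = l • sphereAt y a c := by
  ext i
  simp only [Pi.smul_apply, sphereAt_apply, smul_eq_mul]
  fin_cases i <;> simp [inner_smul_right] <;> ring

lemma sphereAt_add_right (y a : E3) (c d : ℝ) :
    sphereAt y a (c + d) = sphereAt y a c + d • lift y := by
  rw [sphereAt, sphereAt, add_smul, add_assoc]

lemma _root_.HasDerivAt.coord {a : ℝ → E3} {a' : E3} {s : ℝ} (h : HasDerivAt a a' s) (i : Fin 3) :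
    HasDerivAt (fun t => a t i) (a' i) s :=
  (EuclideanSpace.proj (𝕜 := ℝ) i).hasFDerivAt.comp_hasDerivAt s h

lemma _root_.HasDerivAt.lift {x : ℝ → E3} {x' : E3} {s : ℝ} (h : HasDerivAt x x' s) :
    HasDerivAt (fun t => lift (x t)) (sphereAt (x s) x' 0) s := by
  have hn := h.norm_sq
  refine hasDerivAt_pi.2 fun i => ?_
  fin_cases i
  · exact (h.coord 0).congr_deriv (by simp [sphereAt])
  · exact (h.coord 1).congr_deriv (by simp [sphereAt])
  · exact (h.coord 2).congr_deriv (by simp [sphereAt])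
  · exact ((hn.sub_const 1).div_const 2).congr_deriv (by simp [sphereAt])
  · exact ((hn.add_const 1).div_const 2).congr_deriv (by simp [sphereAt])

/-- Tangency of the sphere to the curve removes the term `⟨x', a⟩`. The moving base point
contributes `c` times the derivative of the lift, that is, `c • x'` in the normal slot. -/
lemma _root_.HasDerivAt.sphereAt {x a : ℝ → E3} {c : ℝ → ℝ} {x' a' : E3} {c' s : ℝ}
    (hx : HasDerivAt x x' s) (ha : HasDerivAt a a' s) (hc : HasDerivAt c c' s)
    (h : inner ℝ x' (a s) = (0 : ℝ)) :
    HasDerivAt (fun t => sphereAt (x t) (a t) (c t)) (sphereAt (x s) (a' + c s • x') c') s := by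
  have hi := hx.inner ℝ ha
  rw [h, add_zero] at hi
  have h1 : HasDerivAt (fun t => (![a t 0, a t 1, a t 2, inner ℝ (x t) (a t),
      inner ℝ (x t) (a t)] : L5)) ![a' 0, a' 1, a' 2, inner ℝ (x s) a', inner ℝ (x s) a'] s := by
    refine hasDerivAt_pi.2 fun i => ?_
    fin_cases i
    exacts [ha.coord 0, ha.coord 1, ha.coord 2, hi, hi]
  refine (h1.add (hc.smul hx.lift)).congr_deriv ?_
  ext i
  simp only [Pi.add_apply, Pi.smul_apply, sphereAt_apply, smul_eq_mul]
  fin_cases i <;> simp [inner_add_right, inner_smul_right] <;> ring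

/-- The cross product of `ℝ³`. -/
def cross (a b : E3) : E3 :=
  !₂[a 1 * b 2 - a 2 * b 1, a 2 * b 0 - a 0 * b 2, a 0 * b 1 - a 1 * b 0]

lemma inner_cross (a b c : E3) : inner ℝ (cross a b) c = det3 a b c := by
  rw [inner_E3, det3_eq]
  simp [cross]
  ring

lemma inner_cross_self (a b : E3) :
    inner ℝ (cross a b) (cross a b) = inner ℝ a a * inner ℝ b b - (inner ℝ a b : ℝ) ^ 2 := by
  simp only [inner_E3]
  simp [cross]
  ring

lemma inner_left_cross (a b : E3) : inner ℝ (cross a b) a = (0 : ℝ) := by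
  rw [inner_cross, det3_eq]
  ring

lemma inner_right_cross (a b : E3) : inner ℝ (cross a b) b = (0 : ℝ) := by
  rw [inner_cross, det3_eq]
  ring

lemma contDiff_cross {a b : ℝ → E3} (ha : ContDiff ℝ ∞ a) (hb : ContDiff ℝ ∞ b) :
    ContDiff ℝ ∞ fun s => cross (a s) (b s) := by
  have ha := contDiff_euclidean.1 ha
  have hb := contDiff_euclidean.1 hb
  refine contDiff_euclidean.2 fun i => ?_
  fin_cases i
  · exact ((ha 1).mul (hb 2)).sub ((ha 2).mul (hb 1))
  · exact ((ha 2).mul (hb 0)).sub ((ha 0).mul (hb 2))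
  · exact ((ha 0).mul (hb 1)).sub ((ha 1).mul (hb 0))

lemma eq_sum_of_orthonormal {a b c : E3} (haa : inner ℝ a a = (1 : ℝ))
    (hbb : inner ℝ b b = (1 : ℝ)) (hcc : inner ℝ c c = (1 : ℝ)) (hab : inner ℝ a b = (0 : ℝ))
    (hac : inner ℝ a c = (0 : ℝ)) (hbc : inner ℝ b c = (0 : ℝ)) (v : E3) :
    v = (inner ℝ a v : ℝ) • a + (inner ℝ b v : ℝ) • b + (inner ℝ c v : ℝ) • c := by
  have unit : ∀ {w : E3}, inner ℝ w w = (1 : ℝ) → ‖w‖ = 1 := fun {w} hw => by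
    rwa [real_inner_self_eq_norm_sq, pow_eq_one_iff_of_nonneg (norm_nonneg w) two_ne_zero] at hw
  have hba := real_inner_comm a b ▸ hab
  have hca := real_inner_comm a c ▸ hac
  have hcb := real_inner_comm b c ▸ hbc
  have o : Orthonormal ℝ ![a, b, c] := by
    refine ⟨fun i => ?_, fun i j hij => ?_⟩
    · fin_cases i
      exacts [unit haa, unit hbb, unit hcc]
    · fin_cases i <;> fin_cases j <;> simp_all
  have hs := o.linearIndependent.span_eq_top_of_card_eq_finrank (by simp)
  have := (OrthonormalBasis.mk o hs.ge).sum_repr' v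
  simpa [Fin.sum_univ_three] using this.symm

/-! ### The adapted frame of a curve without vertices. -/

section Curve

variable {x : ℝ → E3}

lemma deriv_eq_smul_arcDeriv {F : Type*} [NormedAddCommGroup F] [NormedSpace ℝ F] {s : ℝ}
    (hr : deriv x s ≠ 0) (f : ℝ → F) : deriv f s = ‖deriv x s‖ • arcDeriv x f s := by
  rw [arcDeriv, smul_smul, mul_inv_cancel₀ (norm_ne_zero_iff.2 hr), one_smul]

/-- The unit vector in the direction of `normalThird`. -/
def unitThird (x : ℝ → E3) (s : ℝ) : E3 := ‖normalThird x s‖⁻¹ • normalThird x s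

/-- The unit vector completing `tangent` and `unitThird` to a positive orthonormal frame. -/
def unitCross (x : ℝ → E3) (s : ℝ) : E3 := cross (tangent x s) (unitThird x s)

/-- The rate of rotation of the osculating sphere. -/
def rotationRate (x : ℝ → E3) (s : ℝ) : ℝ := -inner ℝ (deriv (unitThird x) s) (unitCross x s)

/-- The sphere tangent to the osculating circle with normal `a`. -/
def tangentSphere (x a : ℝ → E3) (s : ℝ) : L5 :=
  sphereAt (x s) (a s) (inner ℝ (a s) (curvVec x s))

lemma inner_tangent_self {s : ℝ} (hr : deriv x s ≠ 0) :
    inner ℝ (tangent x s) (tangent x s) = (1 : ℝ) := by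
  rw [real_inner_self_eq_norm_sq, tangent, arcDeriv, norm_smul, norm_inv, norm_norm,
    inv_mul_cancel₀ (norm_ne_zero_iff.2 hr), one_pow]

lemma contDiff_tangent (hx : ContDiff ℝ ∞ x) (hr : ∀ s, deriv x s ≠ 0) :
    ContDiff ℝ ∞ (tangent x) := contDiff_arcDeriv hx hr hx

lemma contDiff_curvVec (hx : ContDiff ℝ ∞ x) (hr : ∀ s, deriv x s ≠ 0) :
    ContDiff ℝ ∞ (curvVec x) := contDiff_arcDeriv hx hr (contDiff_tangent hx hr)

lemma contDiff_normalThird (hx : ContDiff ℝ ∞ x) (hr : ∀ s, deriv x s ≠ 0) :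
    ContDiff ℝ ∞ (normalThird x) := by
  have h3 := contDiff_arcDeriv hx hr (contDiff_curvVec hx hr)
  have h1 := contDiff_tangent hx hr
  exact h3.sub ((h3.inner ℝ h1).smul h1)

lemma inner_tangent_curvVec (hx : ContDiff ℝ ∞ x) (hr : ∀ s, deriv x s ≠ 0) (s : ℝ) :
    inner ℝ (tangent x s) (curvVec x s) = (0 : ℝ) := by
  have d1 := (contDiff_tangent hx hr).differentiable (by simp) s
  have h := arcDeriv_inner (x := x) d1 d1
  rw [show (fun t => inner ℝ (tangent x t) (tangent x t)) = fun _ => (1 : ℝ) from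
    funext fun t => inner_tangent_self (hr t), real_inner_comm (tangent x s)] at h
  have h0 : arcDeriv x (fun _ : ℝ => (1 : ℝ)) s = 0 := by simp [arcDeriv]
  have h2 : inner ℝ (tangent x s) (arcDeriv x (tangent x) s) = (0 : ℝ) := by
    rw [real_inner_comm] at h ⊢
    linarith
  exact h2

lemma inner_tangent_normalThird {s : ℝ} (hr : deriv x s ≠ 0) :
    inner ℝ (tangent x s) (normalThird x s) = (0 : ℝ) := by
  rw [normalThird, inner_sub_right, inner_smul_right, inner_tangent_self hr,
    real_inner_comm (tangent x s)]
  ring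

lemma contDiff_unitThird (hx : ContDiff ℝ ∞ x) (hr : ∀ s, deriv x s ≠ 0)
    (hP : ∀ s, normalThird x s ≠ 0) : ContDiff ℝ ∞ (unitThird x) := by
  have h := contDiff_normalThird hx hr
  exact ((h.norm ℝ hP).inv fun s => norm_ne_zero_iff.2 (hP s)).smul h

lemma contDiff_unitCross (hx : ContDiff ℝ ∞ x) (hr : ∀ s, deriv x s ≠ 0)
    (hP : ∀ s, normalThird x s ≠ 0) : ContDiff ℝ ∞ (unitCross x) :=
  contDiff_cross (contDiff_tangent hx hr) (contDiff_unitThird hx hr hP)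

lemma inner_unitThird_self {s : ℝ} (hP : normalThird x s ≠ 0) :
    inner ℝ (unitThird x s) (unitThird x s) = (1 : ℝ) := by
  rw [real_inner_self_eq_norm_sq, unitThird, norm_smul, norm_inv, norm_norm,
    inv_mul_cancel₀ (norm_ne_zero_iff.2 hP), one_pow]

lemma inner_tangent_unitThird {s : ℝ} (hr : deriv x s ≠ 0) :
    inner ℝ (tangent x s) (unitThird x s) = (0 : ℝ) := by
  rw [unitThird, inner_smul_right, inner_tangent_normalThird hr, mul_zero]

lemma inner_unitCross_self {s : ℝ} (hr : deriv x s ≠ 0) (hP : normalThird x s ≠ 0) :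
    inner ℝ (unitCross x s) (unitCross x s) = (1 : ℝ) := by
  rw [unitCross, inner_cross_self, inner_tangent_self hr, inner_unitThird_self hP,
    inner_tangent_unitThird hr]
  norm_num

lemma continuous_rotationRate (hx : ContDiff ℝ ∞ x) (hr : ∀ s, deriv x s ≠ 0)
    (hP : ∀ s, normalThird x s ≠ 0) : Continuous (rotationRate x) :=
  (((contDiff_unitThird hx hr hP).continuous_deriv (by simp)).inner
    (contDiff_unitCross hx hr hP).continuous).neg

/-- The osculating spheres of a curve without vertices form a sphere frame. -/
theorem isSphereFrame (hx : ContDiff ℝ ∞ x) (hr : ∀ s, deriv x s ≠ 0)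
    (hP : ∀ s, normalThird x s ≠ 0) :
    IsSphereFrame x (tangentSphere x (unitCross x)) (tangentSphere x (unitThird x))
      (rotationRate x) (fun s => ‖deriv x s‖ * ‖normalThird x s‖) := by
  have frame : ∀ s, HasDerivAt (tangentSphere x (unitCross x))
        (rotationRate x s • tangentSphere x (unitThird x) s) s ∧
      HasDerivAt (tangentSphere x (unitThird x))
        (-rotationRate x s • tangentSphere x (unitCross x) s
          + (‖deriv x s‖ * ‖normalThird x s‖) • lift (x s)) s := by
    intro s
    have Dx := (hx.differentiable (by simp) s).hasDerivAt
    have DF := ((contDiff_tangent hx hr).differentiable (by simp) s).hasDerivAt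
    have DK := ((contDiff_curvVec hx hr).differentiable (by simp) s).hasDerivAt
    have Dm := ((contDiff_unitThird hx hr hP).differentiable (by simp) s).hasDerivAt
    have Dq := ((contDiff_unitCross hx hr hP).differentiable (by simp) s).hasDerivAt
    have hFm : ∀ t, inner ℝ (tangent x t) (unitThird x t) = (0 : ℝ) :=
      fun t => inner_tangent_unitThird (hr t)
    have hqF : ∀ t, inner ℝ (unitCross x t) (tangent x t) = (0 : ℝ) :=
      fun t => inner_left_cross _ _
    have hqm : ∀ t, inner ℝ (unitCross x t) (unitThird x t) = (0 : ℝ) :=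
      fun t => inner_right_cross _ _
    have hmm : ∀ t, inner ℝ (unitThird x t) (unitThird x t) = (1 : ℝ) :=
      fun t => inner_unitThird_self (hP t)
    have hqq : ∀ t, inner ℝ (unitCross x t) (unitCross x t) = (1 : ℝ) :=
      fun t => inner_unitCross_self (hr t) (hP t)
    have const : ∀ {f : ℝ → ℝ} {c d : ℝ}, (∀ t, f t = c) → HasDerivAt f d s → d = 0 := by
      intro f c d hf hd
      rw [show f = fun _ => c from funext hf] at hd
      exact hd.unique (hasDerivAt_const s c)
    have e1 := const hFm (DF.inner ℝ Dm)
    have e2 := const hqF (Dq.inner ℝ DF)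
    have e3 := const hqm (Dq.inner ℝ Dm)
    have e4 := const hmm (Dm.inner ℝ Dm)
    have e5 := const hqq (Dq.inner ℝ Dq)
    have hFK := inner_tangent_curvVec hx hr s
    have expand := eq_sum_of_orthonormal (inner_tangent_self (hr s)) (hmm s) (hqq s) (hFm s)
      (real_inner_comm (tangent x s) (unitCross x s) ▸ hqF s)
      (real_inner_comm (unitThird x s) (unitCross x s) ▸ hqm s)
    have hx' : deriv x s = ‖deriv x s‖ • tangent x s := deriv_eq_smul_arcDeriv (hr s) x
    have hF' : deriv (tangent x) s = ‖deriv x s‖ • curvVec x s := deriv_eq_smul_arcDeriv (hr s) _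
    have hK' : deriv (curvVec x) s = ‖deriv x s‖ • arcDeriv x (curvVec x) s :=
      deriv_eq_smul_arcDeriv (hr s) _
    have hP' : normalThird x s = ‖normalThird x s‖ • unitThird x s := by
      rw [unitThird, smul_smul, mul_inv_cancel₀ (norm_ne_zero_iff.2 (hP s)), one_smul]
    have h3 : arcDeriv x (curvVec x) s = ‖normalThird x s‖ • unitThird x s
        + (inner ℝ (arcDeriv x (curvVec x) s) (tangent x s) : ℝ) • tangent x s := by
      rw [← hP', normalThird, sub_add_cancel]
    have hFm := hFm s
    have hqF := hqF s
    have hqm := hqm s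
    have hmm := hmm s
    have hqq := hqq s
    have em := expand (deriv (unitThird x) s)
    have eq := expand (deriv (unitCross x) s)
    have hθ : rotationRate x s = -inner ℝ (deriv (unitThird x) s) (unitCross x s) := rfl
    rw [hF'] at e1 e2
    rw [hx'] at Dx
    rw [h3] at hK'
    rw [hK'] at DK
    have Tq := Dx.sphereAt Dq (Dq.inner ℝ DK) (by
      rw [inner_smul_left, real_inner_comm, hqF, mul_zero])
    have Tm := Dx.sphereAt Dm (Dm.inner ℝ DK) (by
      rw [inner_smul_left, hFm, mul_zero])
    -- Structure equations of the frame. The tangential parts cancel the terms `c • x'` from the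
    -- moving base point, precisely because `tangentSphere` takes `⟨a, curvVec⟩` as curvature.
    have em' : deriv (unitThird x) s
        = (-(‖deriv x s‖ * inner ℝ (unitThird x s) (curvVec x s))) • tangent x s
          + (-rotationRate x s) • unitCross x s := by
      have h1 : inner ℝ (tangent x s) (deriv (unitThird x) s)
          = -(‖deriv x s‖ * inner ℝ (unitThird x s) (curvVec x s)) := by
        rw [real_inner_smul_left, real_inner_comm (unitThird x s)] at e1
        linarith
      have h2 : inner ℝ (unitThird x s) (deriv (unitThird x) s) = (0 : ℝ) := by
        rw [real_inner_comm] at e4 ⊢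
        linarith
      have h3 : inner ℝ (unitCross x s) (deriv (unitThird x) s) = -rotationRate x s := by
        rw [hθ, neg_neg, real_inner_comm]
      conv_lhs => rw [em, h1, h2, h3, zero_smul, add_zero]
    have eq' : deriv (unitCross x) s
        = (-(‖deriv x s‖ * inner ℝ (unitCross x s) (curvVec x s))) • tangent x s
          + rotationRate x s • unitThird x s := by
      have h1 : inner ℝ (tangent x s) (deriv (unitCross x) s)
          = -(‖deriv x s‖ * inner ℝ (unitCross x s) (curvVec x s)) := by
        rw [real_inner_smul_right, real_inner_comm (tangent x s)] at e2
        linarith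
      have h2 : inner ℝ (unitThird x s) (deriv (unitCross x) s) = rotationRate x s := by
        rw [hθ, real_inner_comm (unitCross x s)]
        rw [real_inner_comm (unitThird x s) (deriv (unitCross x) s)] at e3
        linarith
      have h3 : inner ℝ (unitCross x s) (deriv (unitCross x) s) = (0 : ℝ) := by
        rw [real_inner_comm] at e5 ⊢
        linarith
      conv_lhs => rw [eq, h1, h2, h3, zero_smul, add_zero]
    constructor
    · refine Tq.congr_deriv ?_
      rw [tangentSphere, ← sphereAt_smul, eq']
      congr 1
      · module
      · simp only [real_inner_smul_left, real_inner_smul_right, inner_add_left, inner_add_right,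
          hqm, hqF, hFK]
        ring
    · refine Tm.congr_deriv ?_
      rw [tangentSphere, ← sphereAt_smul, ← sphereAt_add_right, em']
      congr 1
      · module
      · simp only [real_inner_smul_left, real_inner_smul_right, inner_add_left, inner_add_right,
          hmm, hFK, real_inner_comm (tangent x s) (unitThird x s), hFm]
        ring
  exact
  { hasDerivAt_sphere := fun s => (frame s).1
    hasDerivAt_normal := fun s => (frame s).2
    sphere_sphere := fun s => by
      rw [tangentSphere, lor_sphereAt, inner_unitCross_self (hr s) (hP s)]
    normal_normal := fun s => by
      rw [tangentSphere, lor_sphereAt, inner_unitThird_self (hP s)]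
    sphere_normal := fun s => by
      rw [tangentSphere, tangentSphere, lor_sphereAt, unitCross, inner_right_cross]
    lift_sphere := fun s => lor_lift_sphereAt_self _ _ _
    lift_normal := fun s => lor_lift_sphereAt_self _ _ _ }

/-- Differentiating the factor that normalises `P` gives a multiple of `P`, which drops out of the
determinant. -/
lemma rotationRate_eq (hx : ContDiff ℝ ∞ x) (hr : ∀ s, deriv x s ≠ 0)
    (hP : ∀ s, normalThird x s ≠ 0) (s : ℝ) :
    rotationRate x s = -(‖deriv x s‖ * torsionNum x s / confSq x s) := by
  have DP := ((contDiff_normalThird hx hr).differentiable (by simp) s)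
  have hn : DifferentiableAt ℝ (fun t => ‖normalThird x t‖⁻¹) s :=
    (DP.norm ℝ (hP s)).inv (norm_ne_zero_iff.2 (hP s))
  have Dm : deriv (unitThird x) s = ‖normalThird x s‖⁻¹ • deriv (normalThird x) s
      + deriv (fun t => ‖normalThird x t‖⁻¹) s • normalThird x s :=
    (hn.hasDerivAt.smul DP.hasDerivAt).deriv
  have hP' : deriv (normalThird x) s = ‖deriv x s‖ • arcDeriv x (normalThird x) s :=
    deriv_eq_smul_arcDeriv (hr s) _
  have hne := norm_ne_zero_iff.2 (hP s)
  rw [rotationRate, real_inner_comm, unitCross, inner_cross, Dm, hP', unitThird, torsionNum, confSq]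
  simp only [det3_eq, PiLp.add_apply, PiLp.smul_apply, smul_eq_mul]
  field_simp
  ring

lemma confSq_pos {s : ℝ} (hP : normalThird x s ≠ 0) : 0 < confSq x s :=
  pow_pos (norm_pos_iff.2 hP) 2

lemma confTorsion_mul_confSpeed (hx : ContDiff ℝ ∞ x) (hr : ∀ s, deriv x s ≠ 0)
    (hP : ∀ s, normalThird x s ≠ 0) (s : ℝ) :
    confTorsion x s * confSpeed x s = -rotationRate x s := by
  have h := confSq_pos (hP s)
  have h4 : 0 < confSq x s ^ (1 / 4 : ℝ) := Real.rpow_pos_of_pos h _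
  have e : confSq x s ^ (5 / 4 : ℝ) = confSq x s ^ (1 / 4 : ℝ) * confSq x s := by
    rw [← Real.rpow_add_one h.ne']
    norm_num
  rw [rotationRate_eq hx hr hP, confTorsion, confSpeed, e]
  field_simp

/-! ### Contact of order three, and vertices. -/

lemma iteratedDeriv_eq_zero_succ {f : ℝ → ℝ} {s : ℝ} {k : ℕ} (h0 : f s = 0)
    (h : ∀ j ≤ k, iteratedDeriv j (deriv f) s = 0) : ∀ j ≤ k + 1, iteratedDeriv j f s = 0 := by
  rintro (_ | j) hj
  · simpa using h0
  · rw [iteratedDeriv_succ']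
    exact h j (by omega)

/-- Used with `f` the speed, so that orders of vanishing may be counted with arc-length derivatives.
-/
lemma iteratedDeriv_mul_eq_zero {f g : ℝ → ℝ} (hf : ContDiff ℝ ∞ f) (hg : ContDiff ℝ ∞ g)
    {s : ℝ} {k : ℕ} (h : ∀ j ≤ k, iteratedDeriv j g s = 0) :
    ∀ j ≤ k, iteratedDeriv j (fun t => f t * g t) s = 0 := by
  intro j hj
  have := iteratedDeriv_mul (x := s) (n := j) (f := f) (g := g)
    (hf.of_le (by exact_mod_cast le_top)).contDiffAt (hg.of_le (by exact_mod_cast le_top)).contDiffAt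
  rw [Pi.mul_def] at this
  rw [this]
  exact Finset.sum_eq_zero fun i _ => by rw [h (j - i) (by omega), mul_zero]

/-- A sphere tangent to the osculating circle at a zero of `normalThird` has contact of order
three. -/
lemma hasContact_three (hx : ContDiff ℝ ∞ x) (hr : ∀ s, deriv x s ≠ 0) {s : ℝ}
    (hP : normalThird x s = 0) {b : E3} (hb : inner ℝ (tangent x s) b = (0 : ℝ)) :
    HasContact x s (sphereAt (x s) b (inner ℝ (curvVec x s) b)) 3 := by
  set y := x s with hy
  set c : ℝ := inner ℝ (curvVec x s) b with hc
  have cF := contDiff_tangent hx hr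
  have cK := contDiff_curvVec hx hr
  have cL := contDiff_arcDeriv hx hr cK
  have cr : ContDiff ℝ ∞ fun t => ‖deriv x t‖ := (contDiff_infty_iff_deriv.1 hx).2.norm ℝ hr
  have Dx : ∀ t, HasDerivAt x (‖deriv x t‖ • tangent x t) t := fun t =>
    deriv_eq_smul_arcDeriv (x := x) (hr t) x ▸ (hx.differentiable (by simp) t).hasDerivAt
  have DF : ∀ t, HasDerivAt (tangent x) (‖deriv x t‖ • curvVec x t) t := fun t =>
    deriv_eq_smul_arcDeriv (hr t) (tangent x) ▸ (cF.differentiable (by simp) t).hasDerivAt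
  have DK : ∀ t, HasDerivAt (curvVec x) (‖deriv x t‖ • arcDeriv x (curvVec x) t) t := fun t =>
    deriv_eq_smul_arcDeriv (hr t) (curvVec x) ▸ (cK.differentiable (by simp) t).hasDerivAt
  -- `ψ₁`, `ψ₂`, `ψ₃` are the successive arc-length derivatives of the defining function of the
  -- sphere. The choice of `c` makes `ψ₂` vanish at `s`; `ψ₃` vanishes because the third derivative
  -- of `x` is tangential there.
  set ψ₁ : ℝ → ℝ := fun t => inner ℝ (tangent x t) b - c * inner ℝ (x t - y) (tangent x t) with hψ₁
  set ψ₂ : ℝ → ℝ := fun t => inner ℝ (curvVec x t) b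
    - c * (1 + inner ℝ (x t - y) (curvVec x t)) with hψ₂
  set ψ₃ : ℝ → ℝ := fun t => inner ℝ (arcDeriv x (curvVec x) t) b
    - c * inner ℝ (x t - y) (arcDeriv x (curvVec x) t) with hψ₃
  have c₁ : ContDiff ℝ ∞ ψ₁ := (cF.inner ℝ contDiff_const).sub
    (contDiff_const.mul ((hx.sub contDiff_const).inner ℝ cF))
  have c₂ : ContDiff ℝ ∞ ψ₂ := (cK.inner ℝ contDiff_const).sub
    (contDiff_const.mul (contDiff_const.add ((hx.sub contDiff_const).inner ℝ cK)))
  have c₃ : ContDiff ℝ ∞ ψ₃ := (cL.inner ℝ contDiff_const).sub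
    (contDiff_const.mul ((hx.sub contDiff_const).inner ℝ cL))
  have d₀ : deriv (fun t => lor (lift (x t)) (sphereAt y b c)) = fun t => ‖deriv x t‖ * ψ₁ t := by
    funext t
    simp only [lor_lift_sphereAt]
    have h := (Dx t).sub_const y
    refine HasDerivAt.deriv (((h.inner ℝ (hasDerivAt_const t b)).sub
      ((h.norm_sq.const_mul c).div_const 2)).congr_deriv ?_)
    simp only [hψ₁, inner_zero_right, real_inner_smul_left, real_inner_smul_right]
    ring
  have d₁ : deriv ψ₁ = fun t => ‖deriv x t‖ * ψ₂ t := by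
    funext t
    have h := (Dx t).sub_const y
    refine HasDerivAt.deriv ((((DF t).inner ℝ (hasDerivAt_const t b)).sub
      ((h.inner ℝ (DF t)).const_mul c)).congr_deriv ?_)
    simp only [hψ₂, inner_zero_right, real_inner_smul_left, real_inner_smul_right,
      inner_tangent_self (hr t)]
    ring
  have d₂ : deriv ψ₂ = fun t => ‖deriv x t‖ * ψ₃ t := by
    funext t
    have h := (Dx t).sub_const y
    refine HasDerivAt.deriv ((((DK t).inner ℝ (hasDerivAt_const t b)).sub
      (((h.inner ℝ (DK t)).const_add 1).const_mul c)).congr_deriv ?_)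
    simp only [hψ₃, inner_zero_right, real_inner_smul_left, real_inner_smul_right,
      inner_tangent_curvVec hx hr t]
    ring
  have z₃ : ψ₃ s = 0 := by
    have h3 : arcDeriv x (curvVec x) s
        = (inner ℝ (arcDeriv x (curvVec x) s) (tangent x s) : ℝ) • tangent x s := by
      rw [normalThird, sub_eq_zero] at hP
      exact hP
    simp only [hψ₃, hy, sub_self, inner_zero_left, mul_zero, sub_zero]
    rw [h3, real_inner_smul_left, hb, mul_zero]
  have f₃ : ∀ j ≤ 0, iteratedDeriv j ψ₃ s = 0 := by
    intro j hj
    obtain rfl : j = 0 := by omega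
    simpa using z₃
  have f₂ := iteratedDeriv_eq_zero_succ (f := ψ₂) (by simp [hψ₂, hy, hc])
    (d₂ ▸ iteratedDeriv_mul_eq_zero cr c₃ f₃)
  have f₁ := iteratedDeriv_eq_zero_succ (f := ψ₁) (by simp [hψ₁, hy, hb])
    (d₁ ▸ iteratedDeriv_mul_eq_zero cr c₂ f₂)
  exact iteratedDeriv_eq_zero_succ (lor_lift_sphereAt_self _ _ _)
    (d₀ ▸ iteratedDeriv_mul_eq_zero cr c₁ f₁)

lemma exists_orthonormal_orthogonal {v : E3} (hv : v ≠ 0) :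
    ∃ a b : E3, inner ℝ v a = (0 : ℝ) ∧ inner ℝ v b = (0 : ℝ) ∧ inner ℝ a a = (1 : ℝ) ∧
      inner ℝ b b = (1 : ℝ) ∧ inner ℝ a b = (0 : ℝ) := by
  have : Fact (Module.finrank ℝ E3 = 2 + 1) := ⟨by simp⟩
  let B := (stdOrthonormalBasis ℝ (ℝ ∙ v)ᗮ).reindex
    (finCongr (Submodule.finrank_orthogonal_span_singleton (𝕜 := ℝ) (n := 2) hv))
  have hB := orthonormal_iff_ite.1 B.orthonormal
  refine ⟨B 0, B 1, Submodule.mem_orthogonal_singleton_iff_inner_right.1 (B 0).2,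
    Submodule.mem_orthogonal_singleton_iff_inner_right.1 (B 1).2, ?_, ?_, ?_⟩
  exacts [hB 0 0, hB 1 1, hB 0 1]

/-- At a zero of `normalThird` the curve has a vertex. -/
lemma isVertex_of_normalThird_eq_zero (hx : ContDiff ℝ ∞ x) (hr : ∀ s, deriv x s ≠ 0) {s : ℝ}
    (hP : normalThird x s = 0) : IsVertex x s := by
  have hF : tangent x s ≠ 0 := fun h => by
    have := inner_tangent_self (hr s)
    simp [h] at this
  obtain ⟨a, b, ha, hb, haa, hbb, hab⟩ := exists_orthonormal_orthogonal hF
  refine ⟨_, ?_, _, ?_, ?_, hasContact_three hx hr hP ha, hasContact_three hx hr hP hb⟩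
  · exact (lor_sphereAt _ _ _ _ _).trans haa
  · exact (lor_sphereAt _ _ _ _ _).trans hbb
  · rw [lor_sphereAt, hab]
    simp

/-! ### Derivatives of the lift, and identification of the osculating sphere. -/

lemma contDiff_lift (hx : ContDiff ℝ ∞ x) : ContDiff ℝ ∞ fun t => lift (x t) := by
  have h := contDiff_euclidean.1 hx
  have hn := hx.norm_sq ℝ
  refine contDiff_pi.2 fun i => ?_
  fin_cases i
  exacts [h 0, h 1, h 2, (hn.sub contDiff_const).div_const 2, (hn.add contDiff_const).div_const 2]

lemma hasDerivAt_iteratedDeriv_lift (hx : ContDiff ℝ ∞ x) (j : ℕ) (s : ℝ) :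
    HasDerivAt (iteratedDeriv j fun t => lift (x t))
      (iteratedDeriv (j + 1) (fun t => lift (x t)) s) s := by
  rw [iteratedDeriv_succ]
  exact ((contDiff_lift hx).differentiable_iteratedDeriv j
    (by exact_mod_cast WithTop.coe_lt_top _) s).hasDerivAt

lemma iteratedDeriv_lor_lift (hx : ContDiff ℝ ∞ x) (u : L5) (j : ℕ) :
    iteratedDeriv j (fun t => lor (lift (x t)) u)
      = fun s => lor (iteratedDeriv j (fun t => lift (x t)) s) u := by
  induction j with
  | zero => simp
  | succ j ih =>
    rw [iteratedDeriv_succ, ih]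
    exact funext fun s => ((hasDerivAt_iteratedDeriv_lift hx j s).lor_const u).deriv

end Curve

lemma eq_zero_of_hasDerivAt_of_forall_eq_zero {f : ℝ → ℝ} {d s : ℝ} (hf : ∀ t, f t = 0)
    (hd : HasDerivAt f d s) : d = 0 := by
  rw [show f = fun _ => 0 from funext hf] at hd
  exact hd.unique (hasDerivAt_const s 0)

lemma forall_pos_or_forall_neg {f : ℝ → ℝ} (hf : Continuous f) (h0 : ∀ s, f s ≠ 0) :
    (∀ s, 0 < f s) ∨ ∀ s, f s < 0 := by
  rcases lt_or_gt_of_ne (h0 0) with h | h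
  · refine Or.inr fun s => lt_of_not_ge fun hs => ?_
    obtain ⟨t, ht⟩ := mem_range_of_exists_le_of_exists_ge hf ⟨0, h.le⟩ ⟨s, hs⟩
    exact h0 t ht
  · refine Or.inl fun s => lt_of_not_ge fun hs => ?_
    obtain ⟨t, ht⟩ := mem_range_of_exists_le_of_exists_ge hf ⟨s, hs⟩ ⟨0, h.le⟩
    exact h0 t ht

section Frame

variable {x : ℝ → E3} {σ n : ℝ → L5} {w ρ : ℝ → ℝ}

lemma lor_lift_iteratedDeriv (hx : ContDiff ℝ ∞ x) (s : ℝ) :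
    lor (iteratedDeriv 1 (fun t => lift (x t)) s) (lift (x s)) = 0 ∧
    lor (iteratedDeriv 1 (fun t => lift (x t)) s) (iteratedDeriv 1 (fun t => lift (x t)) s)
      = ‖deriv x s‖ ^ 2 ∧
    lor (iteratedDeriv 2 (fun t => lift (x t)) s) (lift (x s)) = -‖deriv x s‖ ^ 2 := by
  have D : ∀ t, HasDerivAt (fun t => lift (x t)) (iteratedDeriv 1 (fun t => lift (x t)) t) t :=
    fun t => by simpa using hasDerivAt_iteratedDeriv_lift hx 0 t
  have D1 := hasDerivAt_iteratedDeriv_lift hx 1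
  have e : ∀ t, iteratedDeriv 1 (fun t => lift (x t)) t = sphereAt (x t) (deriv x t) 0 := fun t =>
    (D t).unique (hx.differentiable (by simp) t).hasDerivAt.lift
  have h1 : ∀ t, lor (iteratedDeriv 1 (fun t => lift (x t)) t) (lift (x t)) = 0 := fun t => by
    rw [e, lor_comm, lor_lift_sphereAt_self]
  have h11 : lor (iteratedDeriv 1 (fun t => lift (x t)) s)
      (iteratedDeriv 1 (fun t => lift (x t)) s) = ‖deriv x s‖ ^ 2 := by
    rw [e, lor_sphereAt, real_inner_self_eq_norm_sq]
  have h2 := eq_zero_of_hasDerivAt_of_forall_eq_zero h1 ((D1 s).lor (D s))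
  exact ⟨h1 s, h11, by linarith⟩

/-- Differentiate `⟨γ, σ⟩ = 0` and `⟨γ, n⟩ = 0` repeatedly using the frame equations. The first
nonzero contribution is `ρ ⟨γ'', γ⟩ = -ρ |x'|²`; it appears in `⟨γ''', n⟩` and one order later,
multiplied by `-w`, in `⟨γ'''', σ⟩`. -/
lemma IsSphereFrame.lor_iteratedDeriv (h : IsSphereFrame x σ n w ρ) (hx : ContDiff ℝ ∞ x) (s : ℝ) :
    (∀ j ≤ 3, lor (iteratedDeriv j (fun t => lift (x t)) s) (σ s) = 0) ∧
    (∀ j ≤ 2, lor (iteratedDeriv j (fun t => lift (x t)) s) (n s) = 0) ∧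
    lor (iteratedDeriv 3 (fun t => lift (x t)) s) (n s) = ρ s * ‖deriv x s‖ ^ 2 ∧
    lor (iteratedDeriv 4 (fun t => lift (x t)) s) (σ s) = -w s * (ρ s * ‖deriv x s‖ ^ 2) := by
  have a : ∀ j t, HasDerivAt (fun t => lor (iteratedDeriv j (fun t => lift (x t)) t) (σ t))
      (lor (iteratedDeriv (j + 1) (fun t => lift (x t)) t) (σ t)
        + w t * lor (iteratedDeriv j (fun t => lift (x t)) t) (n t)) t := fun j t =>
    ((hasDerivAt_iteratedDeriv_lift hx j t).lor (h.hasDerivAt_sphere t)).congr_deriv (by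
      rw [lor_smul_right])
  have b : ∀ j t, HasDerivAt (fun t => lor (iteratedDeriv j (fun t => lift (x t)) t) (n t))
      (lor (iteratedDeriv (j + 1) (fun t => lift (x t)) t) (n t)
        + (-w t * lor (iteratedDeriv j (fun t => lift (x t)) t) (σ t)
          + ρ t * lor (iteratedDeriv j (fun t => lift (x t)) t) (lift (x t)))) t := fun j t =>
    ((hasDerivAt_iteratedDeriv_lift hx j t).lor (h.hasDerivAt_normal t)).congr_deriv (by
      rw [lor_add_right, lor_smul_right, lor_smul_right])
  have a0 : ∀ t, lor (iteratedDeriv 0 (fun t => lift (x t)) t) (σ t) = 0 := fun t => by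
    simpa using h.lift_sphere t
  have b0 : ∀ t, lor (iteratedDeriv 0 (fun t => lift (x t)) t) (n t) = 0 := fun t => by
    simpa using h.lift_normal t
  have c0 : ∀ t, lor (iteratedDeriv 0 (fun t => lift (x t)) t) (lift (x t)) = 0 := fun t => by
    simpa using lor_lift_self (x t)
  have a1 : ∀ t, lor (iteratedDeriv 1 (fun t => lift (x t)) t) (σ t) = 0 := fun t => by
    have := eq_zero_of_hasDerivAt_of_forall_eq_zero a0 (a 0 t)
    rwa [b0, mul_zero, add_zero] at this
  have b1 : ∀ t, lor (iteratedDeriv 1 (fun t => lift (x t)) t) (n t) = 0 := fun t => by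
    have := eq_zero_of_hasDerivAt_of_forall_eq_zero b0 (b 0 t)
    rwa [a0, c0, mul_zero, mul_zero, add_zero, add_zero] at this
  have a2 : ∀ t, lor (iteratedDeriv 2 (fun t => lift (x t)) t) (σ t) = 0 := fun t => by
    have := eq_zero_of_hasDerivAt_of_forall_eq_zero a1 (a 1 t)
    rwa [b1, mul_zero, add_zero] at this
  have b2 : ∀ t, lor (iteratedDeriv 2 (fun t => lift (x t)) t) (n t) = 0 := fun t => by
    have := eq_zero_of_hasDerivAt_of_forall_eq_zero b1 (b 1 t)
    rwa [a1, (lor_lift_iteratedDeriv hx t).1, mul_zero, mul_zero, add_zero, add_zero] at this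
  have a3 : ∀ t, lor (iteratedDeriv 3 (fun t => lift (x t)) t) (σ t) = 0 := fun t => by
    have := eq_zero_of_hasDerivAt_of_forall_eq_zero a2 (a 2 t)
    rwa [b2, mul_zero, add_zero] at this
  have b3 : lor (iteratedDeriv 3 (fun t => lift (x t)) s) (n s) = ρ s * ‖deriv x s‖ ^ 2 := by
    have := eq_zero_of_hasDerivAt_of_forall_eq_zero b2 (b 2 s)
    rw [a2, (lor_lift_iteratedDeriv hx s).2.2] at this
    linarith
  have a4 := eq_zero_of_hasDerivAt_of_forall_eq_zero a3 (a 3 s)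
  rw [b3] at a4
  refine ⟨fun j hj => ?_, fun j hj => ?_, b3, by linarith⟩
  · interval_cases j
    exacts [a0 s, a1 s, a2 s, a3 s]
  · interval_cases j
    exacts [b0 s, b1 s, b2 s]

/-- A stationary osculating sphere has contact of order four. -/
lemma IsSphereFrame.isSpherical (h : IsSphereFrame x σ n w ρ) (hx : ContDiff ℝ ∞ x) {s : ℝ}
    (hw : w s = 0) : IsSpherical x s := by
  refine ⟨σ s, h.sphere_sphere s, fun j hj => ?_⟩
  rw [iteratedDeriv_lor_lift hx]
  obtain ⟨ha, -, -, h4⟩ := h.lor_iteratedDeriv hx s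
  rcases Nat.lt_or_ge j 4 with hj' | hj'
  · exact ha j (by omega)
  · obtain rfl : j = 4 := by omega
    simp only [h4, hw, neg_zero, zero_mul]

lemma lift_ne_zero (y : E3) : lift y ≠ 0 := fun h => by
  have h4 : lift y 4 = 0 := by rw [h]; rfl
  have : (‖y‖ ^ 2 + 1) / 2 = 0 := h4
  exact absurd this (by positivity)

lemma IsSphereFrame.lor_oscVector_ne_zero (h : IsSphereFrame x σ n w ρ) (hx : ContDiff ℝ ∞ x)
    (hr : ∀ s, deriv x s ≠ 0) (hρ : ∀ s, 0 < ρ s) (s : ℝ) : lor (oscVector x s) (σ s) ≠ 0 := by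
  obtain ⟨ha, hb, hb3, -⟩ := h.lor_iteratedDeriv hx s
  obtain ⟨h10, h11, h20⟩ := lor_lift_iteratedDeriv hx s
  have hr2 : 0 < ‖deriv x s‖ ^ 2 := pow_pos (norm_pos_iff.2 (hr s)) 2
  have h00 := lor_lift_self (x s)
  have ss := h.sphere_sphere s
  have sn := h.sphere_normal s
  have a0 := h.lift_sphere s
  have b0 := h.lift_normal s
  have a1 := ha 1 (by norm_num)
  have a2 := ha 2 (by norm_num)
  have a3 := ha 3 (by norm_num)
  have b1 := hb 1 (by norm_num)
  have b2 := hb 2 (by norm_num)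
  have l0 := lift_ne_zero (x s)
  have hb3' : ρ s * ‖deriv x s‖ ^ 2 ≠ 0 := (mul_pos (hρ s) hr2).ne'
  rw [oscVector, lor_wedge]
  generalize iteratedDeriv 1 (fun t => lift (x t)) s = g1 at *
  generalize iteratedDeriv 2 (fun t => lift (x t)) s = g2 at *
  generalize iteratedDeriv 3 (fun t => lift (x t)) s = g3 at *
  generalize lift (x s) = g0 at *
  rw [← isUnit_iff_ne_zero, ← Matrix.isUnit_iff_isUnit_det,
    ← Matrix.linearIndependent_rows_iff_isUnit]
  change LinearIndependent ℝ ![g0, g1, g2, g3, σ s]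
  rw [Fintype.linearIndependent_iff]
  intro c hc
  simp only [Fin.sum_univ_five] at hc
  replace hc : c 0 • g0 + c 1 • g1 + c 2 • g2 + c 3 • g3 + c 4 • σ s = 0 := hc
  -- Pairing with `σ`, `n`, `γ`, `γ'` in turn gives a triangular system for the coefficients `c 4`,
  -- `c 3`, `c 2`, `c 1`.
  have pair : ∀ u, c 0 * lor g0 u + c 1 * lor g1 u + c 2 * lor g2 u + c 3 * lor g3 u
      + c 4 * lor (σ s) u = 0 := fun u => by
    have := congrArg (fun v => lor v u) hc
    simp only [lor_add_left, lor_smul_left] at this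
    rw [this]
    simp [lor]
  have c4 : c 4 = 0 := by
    have := pair (σ s)
    rw [a0, a1, a2, a3, ss] at this
    linarith
  have c3 : c 3 = 0 := by
    have := pair (n s)
    rw [b0, b1, b2, hb3, sn] at this
    have : c 3 * (ρ s * ‖deriv x s‖ ^ 2) = 0 := by linarith
    exact (mul_eq_zero.1 this).resolve_right hb3'
  have c2 : c 2 = 0 := by
    have := pair g0
    rw [h00, h10, h20, c3, c4] at this
    have : c 2 * ‖deriv x s‖ ^ 2 = 0 := by linarith
    exact (mul_eq_zero.1 this).resolve_right hr2.ne'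
  have c1 : c 1 = 0 := by
    have := pair g1
    rw [lor_comm g0, h10, h11, c2, c3, c4] at this
    have : c 1 * ‖deriv x s‖ ^ 2 = 0 := by linarith
    exact (mul_eq_zero.1 this).resolve_right hr2.ne'
  have c0 : c 0 = 0 := by
    rw [c1, c2, c3, c4] at hc
    simp only [zero_smul, add_zero] at hc
    exact (smul_eq_zero.1 hc).resolve_right l0
  intro i
  fin_cases i
  exacts [c0, c1, c2, c3, c4]

/-- The difference of the two sides is orthogonal to `γ, γ', γ'', γ'''` and `σ`, which form a basis.
-/
lemma IsSphereFrame.oscVector_eq (h : IsSphereFrame x σ n w ρ) (hx : ContDiff ℝ ∞ x)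
    (hr : ∀ s, deriv x s ≠ 0) (hρ : ∀ s, 0 < ρ s) (s : ℝ) :
    oscVector x s = lor (oscVector x s) (σ s) • σ s := by
  have hdet := h.lor_oscVector_ne_zero hx hr hρ s
  obtain ⟨ha, -, -, -⟩ := h.lor_iteratedDeriv hx s
  have ss := h.sphere_sphere s
  have a0 := h.lift_sphere s
  have a1 := ha 1 (by norm_num)
  have a2 := ha 2 (by norm_num)
  have a3 := ha 3 (by norm_num)
  set d := lor (oscVector x s) (σ s) with hd
  set u : L5 := oscVector x s + (-d) • σ s with hu
  have huσ : lor (σ s) u = 0 := by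
    rw [hu, lor_add_right, lor_smul_right, ss, lor_comm, ← hd]
    ring
  have orth : ∀ v, lor (oscVector x s) v = 0 → lor v (σ s) = 0 → lor v u = 0 := by
    intro v h1 h2
    rw [hu, lor_add_right, lor_smul_right, h2, lor_comm, h1]
    ring
  -- Flipping the last sign turns Lorentz products with `u` into dot products, so the matrix with
  -- the basis as rows kills this vector.
  have hu0 : (![u 0, u 1, u 2, u 3, -u 4] : L5) = 0 := by
    rw [hd, oscVector, lor_wedge] at hdet
    refine Matrix.eq_zero_of_mulVec_eq_zero hdet ?_
    have e : ∀ v : L5, v ⬝ᵥ ![u 0, u 1, u 2, u 3, -u 4] = lor v u := fun v => by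
      simp [dotProduct, Fin.sum_univ_five, lor]
      ring
    ext i
    simp only [Matrix.mulVec, e]
    have rep : ∀ i j : Fin 5, i ≠ j → ∀ M : Matrix (Fin 5) (Fin 5) ℝ, M i = M j → M.det = 0 :=
      fun i j hij M hM => Matrix.det_zero_of_row_eq hij hM
    fin_cases i
    · exact orth _ ((lor_wedge _ _ _ _ _).trans (rep 0 4 (by decide) _ rfl)) a0
    · exact orth _ ((lor_wedge _ _ _ _ _).trans (rep 1 4 (by decide) _ rfl)) a1
    · exact orth _ ((lor_wedge _ _ _ _ _).trans (rep 2 4 (by decide) _ rfl)) a2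
    · exact orth _ ((lor_wedge _ _ _ _ _).trans (rep 3 4 (by decide) _ rfl)) a3
    · exact huσ
  have hu1 : u = 0 := by
    ext i
    have := congrFun hu0
    fin_cases i
    exacts [this 0, this 1, this 2, this 3, neg_eq_zero.1 (this 4)]
  rw [hu, neg_smul, ← sub_eq_add_neg, sub_eq_zero] at hu1
  exact hu1

/-- Up to a global sign, the sphere of the frame is the oriented osculating sphere. -/
lemma IsSphereFrame.oscSphere_eq (h : IsSphereFrame x σ n w ρ) (hx : ContDiff ℝ ∞ x)
    (hr : ∀ s, deriv x s ≠ 0) (hρ : ∀ s, 0 < ρ s) : oscSphere x = σ ∨ oscSphere x = -σ := by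
  have hd := h.lor_oscVector_ne_zero hx hr hρ
  have cont : Continuous fun s => lor (oscVector x s) (σ s) := by
    have cg : ∀ j, Continuous (iteratedDeriv j fun t => lift (x t)) := fun j =>
      continuous_iff_continuousAt.2 fun s => (hasDerivAt_iteratedDeriv_lift hx j s).continuousAt
    have cσ : Continuous σ := continuous_iff_continuousAt.2 fun s =>
      (h.hasDerivAt_sphere s).continuousAt
    simp only [oscVector, lor_wedge]
    refine Continuous.matrix_det (continuous_matrix fun i j => ?_)
    fin_cases i
    exacts [(continuous_apply j).comp (contDiff_lift hx).continuous,
      (continuous_apply j).comp (cg 1), (continuous_apply j).comp (cg 2),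
      (continuous_apply j).comp (cg 3), (continuous_apply j).comp cσ]
  have eq : ∀ s, oscSphere x s
      = (|lor (oscVector x s) (σ s)|⁻¹ * lor (oscVector x s) (σ s)) • σ s := by
    intro s
    have e := h.oscVector_eq hx hr hρ s
    have hn : lorNorm (oscVector x s) = |lor (oscVector x s) (σ s)| := by
      rw [lorNorm]
      conv_lhs => rw [e]
      rw [lor_smul_left, lor_smul_right, h.sphere_sphere, mul_one, Real.sqrt_mul_self_eq_abs]
    rw [oscSphere, hn, mul_smul, ← e]
  rcases forall_pos_or_forall_neg cont hd with hs | hs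
  · refine Or.inl (funext fun s => ?_)
    rw [eq, abs_of_pos (hs s), inv_mul_cancel₀ (hd s), one_smul]
  · refine Or.inr (funext fun s => ?_)
    rw [eq, abs_of_neg (hs s), inv_neg, neg_mul, inv_mul_cancel₀ (hd s), neg_smul, one_smul,
      Pi.neg_apply]

lemma IsSphereFrame.lorNorm_deriv_oscSphere (h : IsSphereFrame x σ n w ρ) (hx : ContDiff ℝ ∞ x)
    (hr : ∀ s, deriv x s ≠ 0) (hρ : ∀ s, 0 < ρ s) (s : ℝ) :
    lorNorm (deriv (oscSphere x) s) = |w s| := by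
  have hs := h.hasDerivAt_sphere s
  have hn := h.normal_normal s
  rcases h.oscSphere_eq hx hr hρ with e | e
  · rw [e, hs.deriv, lorNorm, lor_smul_left, lor_smul_right, hn, mul_one,
      Real.sqrt_mul_self_eq_abs]
  · rw [e, hs.neg.deriv, lorNorm, lor_neg_left, lor_neg_right, neg_neg, lor_smul_left,
      lor_smul_right, hn, mul_one, Real.sqrt_mul_self_eq_abs]

end Frame

/-! ### Periodicity of the frame. -/

section Periodic

variable {x : ℝ → E3} {p : ℝ}

lemma periodic_deriv {F : Type*} [NormedAddCommGroup F] [NormedSpace ℝ F] {f : ℝ → F}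
    (hf : Function.Periodic f p) : Function.Periodic (deriv f) p := fun s => by
  rw [← deriv_comp_add_const, show (fun t => f (t + p)) = f from funext hf]

lemma periodic_arcDeriv {F : Type*} [NormedAddCommGroup F] [NormedSpace ℝ F] {f : ℝ → F}
    (hx : Function.Periodic x p) (hf : Function.Periodic f p) :
    Function.Periodic (arcDeriv x f) p := fun s => by
  rw [arcDeriv, arcDeriv, periodic_deriv hx s, periodic_deriv hf s]

lemma periodic_tangentSphere {a : ℝ → E3} (hx : Function.Periodic x p)
    (ha : Function.Periodic a p) : Function.Periodic (tangentSphere x a) p := by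
  have hK : Function.Periodic (curvVec x) p := periodic_arcDeriv hx (periodic_arcDeriv hx hx)
  intro s
  rw [tangentSphere, tangentSphere, hx s, ha s, hK s]

lemma periodic_unitThird (hx : Function.Periodic x p) : Function.Periodic (unitThird x) p := by
  have hF : Function.Periodic (tangent x) p := periodic_arcDeriv hx hx
  have hL : Function.Periodic (arcDeriv x (curvVec x)) p :=
    periodic_arcDeriv hx (periodic_arcDeriv hx hF)
  intro s
  rw [unitThird, unitThird, normalThird, normalThird, hF s, hL s]

lemma periodic_unitCross (hx : Function.Periodic x p) : Function.Periodic (unitCross x) p := by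
  have hF : Function.Periodic (tangent x) p := periodic_arcDeriv hx hx
  intro s
  rw [unitCross, unitCross, hF s, periodic_unitThird hx s]

/-- Supplies the strictly negative forcing needed by the Sturm argument: `⟨lift (x r), lift y⟩ < 0`
as soon as `x r ≠ y`. -/
lemma exists_ne_of_deriv_ne_zero (hr : ∀ s, deriv x s ≠ 0) (y : E3) {a b : ℝ} (hab : a < b) :
    ∃ r ∈ Set.Ioo a b, x r ≠ y := by
  by_contra! h
  have hm : (a + b) / 2 ∈ Set.Ioo a b := ⟨by linarith, by linarith⟩
  have he : x =ᶠ[nhds ((a + b) / 2)] fun _ => y := by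
    filter_upwards [Ioo_mem_nhds hm.1 hm.2] with r hr using h r hr
  exact hr _ (by rw [he.deriv_eq, deriv_const])

end Periodic

end ConformalCurve

end

/-! ### The theorem. -/

open ConformalCurve in
theorem mainTheorem2 (x : ℝ → ConformalCurve.E3) (p : ℝ)
    (hx : ConformalCurve.IsClosedCurve x p)
    (hvertex : ∀ s, ¬ ConformalCurve.IsVertex x s)
    (hspherical : ∀ s, ¬ ConformalCurve.IsSpherical x s) :
    (∀ s, ConformalCurve.confTorsion x s ≠ 0) ∧
      ConformalCurve.omegaIntegral x p = |ConformalCurve.torsionIntegral x p| ∧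
      2 * Real.pi ≤ |ConformalCurve.torsionIntegral x p| := by
  obtain ⟨hs, hr, hp, hper⟩ := hx
  have hP : ∀ s, normalThird x s ≠ 0 := fun s h =>
    hvertex s (isVertex_of_normalThird_eq_zero hs hr h)
  have hρ : ∀ s, 0 < ‖deriv x s‖ * ‖normalThird x s‖ := fun s =>
    mul_pos (norm_pos_iff.2 (hr s)) (norm_pos_iff.2 (hP s))
  have F := isSphereFrame hs hr hP
  have hne : ∀ s, rotationRate x s ≠ 0 := fun s h => hspherical s (F.isSpherical hs h)
  have hc := continuous_rotationRate hs hr hP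
  have hT := confTorsion_mul_confSpeed hs hr hP
  have hσ := periodic_tangentSphere hper (periodic_unitCross hper) 0
  have hn := periodic_tangentSphere hper (periodic_unitThird hper) 0
  rw [zero_add] at hσ hn
  have hI : torsionIntegral x p = -∫ s in (0 : ℝ)..p, rotationRate x s := by
    rw [torsionIntegral, ← intervalIntegral.integral_neg]
    simp_rw [hT]
  have hω : omegaIntegral x p = ∫ s in (0 : ℝ)..p, |rotationRate x s| := by
    rw [omegaIntegral]
    simp_rw [F.lorNorm_deriv_oscSphere hs hr hρ]
  have key : omegaIntegral x p = |torsionIntegral x p| ∧ 2 * Real.pi ≤ omegaIntegral x p := by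
    rw [hω, hI, abs_neg]
    rcases forall_pos_or_forall_neg hc hne with h | h
    · have bound := F.two_pi_le_integral hc h hρ hp hσ hn
        fun a b hab => exists_ne_of_deriv_ne_zero hr _ hab
      simp_rw [fun s => abs_of_pos (h s)]
      exact ⟨(abs_of_nonneg (by linarith [Real.pi_pos])).symm, bound⟩
    -- For negative rotation rate the length bound applies to the frame with `σ` reversed.
    · have bound := F.neg.two_pi_le_integral hc.neg (fun s => neg_pos.2 (h s)) hρ hp
        (congrArg Neg.neg hσ) hn fun a b hab => exists_ne_of_deriv_ne_zero hr _ hab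
      simp only [Pi.neg_apply] at bound
      simp_rw [fun s => abs_of_neg (h s)]
      refine ⟨?_, bound⟩
      rw [intervalIntegral.integral_neg] at bound ⊢
      exact (abs_of_nonpos (by linarith [Real.pi_pos])).symm
  refine ⟨fun s h => hne s ?_, key.1, key.1 ▸ key.2⟩
  have := hT s
  rw [h, zero_mul] at this
  linarith
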